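/- Fix $0<b_1\le b_2$. There are constants $K,C>0$, depending only on $b_1,b_2$, such that the following holds for all $B\in[b_1,b_2]$ (that is, $B=\Theta(1)$), all dimensions $d$, all $T\ge 1$, all $\delta\in(0,\tfrac12]$, all probability measures $p_{\mathsf{data}}$ on $\mathbb R^d$ (no further assumption), and all parameters $\alpha_t\ne 0$, $\eta_t>0$, $0\le t<T$. Let $X_0\sim p_{\mathsf{data}}$ and $X_{t+1}\mid X_t\sim \mathsf N(\alpha_t X_t,\alpha_t^2\eta_t I)$, so that $X_t\mid X_0\sim\mathsf N(\bar\alpha_t X_0,\sigma_t^2 I)$ with $\bar\alpha_t=\prod_{s<t}\alpha_s$, $\sigma_0^2=0$, $\sigma_{t+1}^2=\alpha_t^2(\sigma_t^2+\eta_t)$. Let $p_t$ be the law of $X_t$, and for $t\ge1$ also its smooth density, the Gaussian mixture $p_t(x)=\int (2\pi\sigma_t^2)^{-d/2}e^{-\|x-\bar\alpha_t y\|^2/(2\sigma_t^2)}\,p_{\mathsf{data}}(dy)$. Let $\mathsf s_t:\mathbb R^d\to\mathbb R^d$ be measurable score estimates and $\varepsilon_{\mathsf{score},t}^2=\mathbb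 E_{X_t\sim p_t}\|\mathsf s_t(X_t)-\nabla\log p_t(X_t)\|^2\in[0,\infty]$. Assume $$\frac{\sigma_t^2}{\eta_t}\ \ge\ K\bigl(d\log(1/\delta)+\log^2(1/\delta)\bigr),\qquad 1\le t\le T-1.$$ First-order rejection sampling $\mathsf{FORS}(B,q,(\mathcal W_x)_x)$, with proposal distribution $q$ on $\mathbb R^d$ and estimator distributions $\mathcal W_x$ on $[-B,B]$, repeats the following independent iterations until a point is output: sample $x\sim q$, $J\sim\mathsf{Poisson}(2B)$, and $W_1,\dots,W_J\sim\mathcal W_x$ i.i.d.; output $x$ with probability $\prod_{j=1}^J\frac{B+W_j}{2B}$. Let $\widehat p_T$ be any probability measure on $\mathbb R^d$. Backward diffusion sampling draws $X_T\sim\widehat p_T$ and then, for $t=T-1,\dots,1$, lets $X_t$ be the output of $\mathsf{FORS}(B,q_t,(\mathcal W^t_x)_x)$, where, with $\bar x_t=\alpha_t^{-1}X_{t+1}$, $q_t=\mathsf N(\bar x_t,\eta_t I)$ and $\mathcal W^t_x$ is the law of $\max\{-B,\min\{B,\langle x-\bar x_t,\mathsf s_t(rx+(1-r)\bar x_t)\rangle\}\}$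 for $r\sim\mathsf{Unif}([0,1])$. Then the sampler terminates almost surely, so that the law $\widehat p_1$ of its output $X_1$ is a probability measure, and (with values in $[0,\infty]$) $$\mathrm{KL}(p_1\,\|\,\widehat p_1)\ \le\ C\Bigl(\mathrm{KL}(p_T\,\|\,\widehat p_T)+T\delta+\sum_{t=1}^{T-1}\eta_t\,\varepsilon_{\mathsf{score},t}^2\Bigr).$$ -/

import Mathlib

open MeasureTheory ProbabilityTheory InformationTheory
open scoped ENNReal NNReal

noncomputable section

namespace Diffusion

/-- `ℝ^d` with the Euclidean norm. -/
abbrev Vec (d : ℕ) : Type := EuclideanSpace ℝ (Fin d)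

/-- The isotropic Gaussian `N(m, v I)` on `ℝ^d`. -/
def isoGaussian {d : ℕ} (m : Vec d) (v : ℝ) : Measure (Vec d) :=
  multivariateGaussian m (v • (1 : Matrix (Fin d) (Fin d) ℝ))

/-! ### The forward process -/

/-- The law `p_t` of `X_t` for the Markov chain
`X_0 ∼ pdata`, `X_{t+1} ∣ X_t ∼ N(α_t X_t, α_t² η_t I)`. -/
def forwardLaw {d : ℕ} (α η : ℕ → ℝ) (pdata : Measure (Vec d)) : ℕ → Measure (Vec d)
  | 0 => pdata
  | t + 1 => (forwardLaw α η pdata t).bind fun x => isoGaussian (α t • x) (α t ^ 2 * η t)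

/-- `ᾱ_t = ∏_{s < t} α_s`. -/
def scale (α : ℕ → ℝ) (t : ℕ) : ℝ := ∏ s ∈ Finset.range t, α s

/-- `σ_t²`, with `σ_0² = 0` and `σ_{t+1}² = α_t² (σ_t² + η_t)`, so that
`X_t ∣ X_0 ∼ N(ᾱ_t X_0, σ_t² I)`. -/
def noiseVar (α η : ℕ → ℝ) : ℕ → ℝ
  | 0 => 0
  | t + 1 => α t ^ 2 * (noiseVar α η t + η t)

/-- The (smooth, positive, for `t ≥ 1`) probability density of `X_t`: the average over
`X_0 ∼ pdata` of the density of `N(ᾱ_t X_0, σ_t² I)`. -/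
def forwardDensity {d : ℕ} (α η : ℕ → ℝ) (pdata : Measure (Vec d)) (t : ℕ) (x : Vec d) : ℝ :=
  ∫ y, (Real.sqrt (2 * Real.pi * noiseVar α η t) ^ d)⁻¹ *
    Real.exp (-‖x - scale α t • y‖ ^ 2 / (2 * noiseVar α η t)) ∂pdata

/-- The true score `∇ log p_t`. -/
def score {d : ℕ} (α η : ℕ → ℝ) (pdata : Measure (Vec d)) (t : ℕ) (x : Vec d) : Vec d :=
  gradient (fun y => Real.log (forwardDensity α η pdata t y)) x

/-- The squared score error `E_{X_t ∼ p_t} ‖s_t(X_t) - ∇ log p_t(X_t)‖²` (possibly `∞`). -/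
def scoreErrorSq {d : ℕ} (α η : ℕ → ℝ) (pdata : Measure (Vec d)) (s : ℕ → Vec d → Vec d)
    (t : ℕ) : ℝ≥0∞ :=
  ∫⁻ x, ENNReal.ofReal (‖s t x - score α η pdata t x‖ ^ 2) ∂(forwardLaw α η pdata t)

/-! ### First-order rejection sampling -/

/-- The probability that an iteration which has drawn the point `x` outputs it, `W` being the
estimator distribution at `x`: draw `J ∼ Poisson(2B)`, then `W_1, …, W_J` i.i.d. from `W`, and
accept with probability `∏_{j ≤ J} (B + W_j) / (2B)`. -/
def forsAccept (B : ℝ) (W : Measure ℝ) : ℝ≥0∞ :=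
  ∫⁻ J, ∫⁻ w : Fin J → ℝ, ENNReal.ofReal (∏ j, (B + w j) / (2 * B))
    ∂(Measure.pi fun _ : Fin J => W) ∂(poissonMeasure (2 * B).toNNReal)

/-- For one iteration: the law of the point `x ∼ q` on the event that it is output. -/
def forsHit {d : ℕ} (B : ℝ) (q : Measure (Vec d)) (W : Vec d → Measure ℝ) : Measure (Vec d) :=
  q.withDensity fun x => forsAccept B (W x)

/-- The probability that one iteration outputs nothing. -/
def forsMiss {d : ℕ} (B : ℝ) (q : Measure (Vec d)) (W : Vec d → Measure ℝ) : ℝ≥0∞ :=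
  ∫⁻ x, (1 - forsAccept B (W x)) ∂q

/-- The law of the output of first-order rejection sampling with parameter `B`, proposal `q` and
estimator distributions `W x`. The iterations are independent and the loop stops at the first
output; the `i`-th summand is the law of the output on the event that the first `i` iterations
output nothing and the next one outputs its point. -/
def forsLaw {d : ℕ} (B : ℝ) (q : Measure (Vec d)) (W : Vec d → Measure ℝ) : Measure (Vec d) :=
  Measure.sum fun i : ℕ => forsMiss B q W ^ i • forsHit B q W

/-! ### Backward diffusion sampling -/

/-- `clip_B(a) = max{-B, min{B, a}}`. -/
def clip (B a : ℝ) : ℝ := max (-B) (min B a)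

/-- The law of `clip_B ⟨x - x̄, s(r x + (1 - r) x̄)⟩` for `r ∼ Unif[0,1]`. -/
def lineEstimator {d : ℕ} (B : ℝ) (s : Vec d → Vec d) (xbar x : Vec d) : Measure ℝ :=
  (volume.restrict (Set.Icc (0 : ℝ) 1)).map fun r =>
    clip B (inner ℝ (x - xbar) (s (r • x + (1 - r) • xbar)))

/-- The conditional law of the sampler's `X_t` given `X_{t+1} = x'`: the output of first-order
rejection sampling with proposal `N(x̄, η_t I)`, where `x̄ = α_t⁻¹ x'`, and the clipped
straight-line estimators. -/
def backwardStep {d : ℕ} (B : ℝ) (α η : ℕ → ℝ) (s : ℕ → Vec d → Vec d) (t : ℕ) (x' : Vec d) :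
    Measure (Vec d) :=
  forsLaw B (isoGaussian ((α t)⁻¹ • x') (η t)) (lineEstimator B (s t) ((α t)⁻¹ • x'))

/-- `backwardLaw B α η s μ t k` is the law of the sampler's `X_t` when it is started at time
`t + k` with `X_{t+k} ∼ μ`, and performs the `k` backward steps from `t + k` down to `t`. -/
def backwardLaw {d : ℕ} (B : ℝ) (α η : ℕ → ℝ) (s : ℕ → Vec d → Vec d) (μ : Measure (Vec d)) :
    ℕ → ℕ → Measure (Vec d)
  | _, 0 => μ
  | t, k + 1 => (backwardLaw B α η s μ (t + 1) k).bind (backwardStep B α η s t)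

end Diffusion

end

/-!
The chain is reversed one step at a time. In the coordinate `x̄ = X_{t+1} / α_t` a forward step is a
step of the heat kernel, which is reversible with respect to Lebesgue measure, so its time reversal
started from `p_t` is the heat kernel tilted by `log p_t`, whereas rejection sampling outputs from
`x̄` the heat kernel tilted by the mean `l(x̄, ·)` of the clipped estimator. By the chain rule for
the relative entropy, the step loses at most the integral of
`p_t(x) ψ(log p_t(x) - log p_t(x̄) - l(x̄, x))`, where `ψ(y) = y - (1 - e⁻ʸ)`; comparing with an
unnormalised tilt avoids the partition functions.

As `log p_t(x) - log p_t(x̄)` is the integral of the score along the segment from `x̄` to `x`,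
Jensen's inequality and a translation move the score to the point `z` at which its error is averaged
under `p_t`. Where the directional score and the log-density ratio stay below `B`, the defect `ψ` is
quadratic in the score error, with mean `η_t ε_t²`. The complement has small probability by
exponential moments of order `m ≍ log (1/δ)`, which are controlled by the convexity of
`log p_t + ‖·‖² / (2 σ_t²)`: they reduce to the mass of translates of `p_t` and to a Gaussian
integral, finite because `m² η_t ≤ σ_t² / 2`.
-/

noncomputable section

namespace Diffusion

/-! ### The defect of the exponential inequality -/

/-- The defect `y - (1 - e⁻ʸ)` in the inequality `1 - e⁻ʸ ≤ y`. It is the integrand of the relative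
entropy of two densities, seen from the first one, as a function of the difference `y` of their
logarithms. -/
def expDefect (y : ℝ) : ℝ := y + Real.exp (-y) - 1

@[fun_prop]
lemma continuous_expDefect : Continuous expDefect := by unfold expDefect; fun_prop

lemma expDefect_nonneg (y : ℝ) : 0 ≤ expDefect y := by
  have := Real.one_sub_le_exp_neg y
  unfold expDefect
  linarith

lemma convexOn_expDefect : ConvexOn ℝ Set.univ expDefect :=
  ((convexOn_id convex_univ).add (convexOn_exp.comp_linearMap (-LinearMap.id))).sub
    (concaveOn_const 1 convex_univ)

lemma expDefect_le_exp_abs (y : ℝ) : expDefect y ≤ Real.exp |y| := by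
  unfold expDefect
  rcases le_total 0 y with hy | hy
  · have := Real.exp_le_one_iff.2 (neg_nonpos.2 hy)
    have := Real.add_one_le_exp y
    rw [abs_of_nonneg hy]
    linarith
  · rw [abs_of_nonpos hy]
    linarith

lemma expDefect_le_sq_mul_exp_abs (y : ℝ) : expDefect y ≤ y ^ 2 * Real.exp |y| := by
  have h := Complex.norm_exp_sub_sum_le_norm_mul_exp ((-y : ℝ) : ℂ) 2
  rw [Complex.norm_real, Real.norm_eq_abs, abs_neg, sq_abs] at h
  refine le_trans (le_of_eq ?_) h
  rw [← Real.norm_of_nonneg (expDefect_nonneg y), ← Complex.norm_real, expDefect]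
  congr 1
  simp [Finset.sum_range_succ]
  ring

lemma mul_klFun_div {a b : ℝ} (ha : 0 < a) (hb : 0 < b) :
    b * klFun (a / b) = a * expDefect (Real.log a - Real.log b) := by
  rw [klFun_apply, expDefect, neg_sub, Real.exp_sub, Real.exp_log ha, Real.exp_log hb,
    Real.log_div ha.ne' hb.ne']
  field_simp

/-! ### Relative entropy -/

section RelativeEntropy

variable {X Y : Type*} [MeasurableSpace X] [MeasurableSpace Y]

lemma klDiv_withDensity_withDensity {π : Measure X} {f g : X → ℝ} (hf : Measurable f)
    (hg : Measurable g) (hf0 : ∀ x, 0 < f x) (hg0 : ∀ x, 0 < g x)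
    [IsFiniteMeasure (π.withDensity fun x => ENNReal.ofReal (f x))]
    [IsFiniteMeasure (π.withDensity fun x => ENNReal.ofReal (g x))] :
    klDiv (π.withDensity fun x => ENNReal.ofReal (f x))
        (π.withDensity fun x => ENNReal.ofReal (g x)) =
      ∫⁻ x, ENNReal.ofReal (f x * expDefect (Real.log (f x) - Real.log (g x))) ∂π := by
  set μ := π.withDensity fun x => ENNReal.ofReal (f x)
  set ν := π.withDensity fun x => ENNReal.ofReal (g x)
  have hr : Measurable fun x => ENNReal.ofReal (f x / g x) := (hf.div hg).ennreal_ofReal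
  have hμ : μ = ν.withDensity fun x => ENNReal.ofReal (f x / g x) := by
    rw [← withDensity_mul _ hg.ennreal_ofReal hr]
    refine congrArg π.withDensity (funext fun x => ?_)
    rw [Pi.mul_apply, ← ENNReal.ofReal_mul (hg0 x).le, mul_div_cancel₀ _ (hg0 x).ne']
  have hrn : μ.rnDeriv ν =ᵐ[ν] fun x => ENNReal.ofReal (f x / g x) :=
    hμ ▸ Measure.rnDeriv_withDensity ν hr
  calc klDiv μ ν = ∫⁻ x, ENNReal.ofReal (klFun (μ.rnDeriv ν x).toReal) ∂ν :=
        klDiv_eq_lintegral_klFun_of_ac (hμ ▸ withDensity_absolutelyContinuous _ _)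
    _ = ∫⁻ x, ENNReal.ofReal (klFun (f x / g x)) ∂ν := lintegral_congr_ae <| hrn.mono fun x hx => by
        simp only [hx, ENNReal.toReal_ofReal (div_pos (hf0 x) (hg0 x)).le]
    _ = ∫⁻ x, ENNReal.ofReal (f x * expDefect (Real.log (f x) - Real.log (g x))) ∂π := by
        rw [lintegral_withDensity_eq_lintegral_mul _ hg.ennreal_ofReal (by fun_prop)]
        refine lintegral_congr fun x => ?_
        rw [Pi.mul_apply, ← ENNReal.ofReal_mul (hg0 x).le, mul_klFun_div (hf0 x) (hg0 x)]

lemma klDiv_bind_le [StandardBorelSpace X] [Nonempty X] (μ : Measure X) [IsFiniteMeasure μ]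
    (κ : Kernel X Y) [IsMarkovKernel κ] (ν ρ : Measure Y) [IsFiniteMeasure ν] [IsFiniteMeasure ρ]
    (Q : Kernel Y X) [IsMarkovKernel Q] :
    klDiv μ (ν.bind Q) ≤ klDiv (μ.bind κ) ν + klDiv ((μ ⊗ₘ κ).map Prod.swap) (ρ ⊗ₘ Q) := by
  calc klDiv μ (ν.bind Q)
      = klDiv (((μ.bind κ) ⊗ₘ (κ†μ)).map Prod.snd) ((ν ⊗ₘ Q).map Prod.snd) := by
        rw [← Measure.snd, ← Measure.snd, Measure.snd_compProd, Measure.snd_compProd,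
          posterior_comp_self]
    _ ≤ klDiv ((μ.bind κ) ⊗ₘ (κ†μ)) (ν ⊗ₘ Q) := klDiv_map_le _ _ measurable_snd
    _ = klDiv (μ.bind κ) ν + klDiv ((μ.bind κ) ⊗ₘ (κ†μ)) ((μ.bind κ) ⊗ₘ Q) :=
        klDiv_compProd_eq_add _ _ _ _
    _ ≤ klDiv (μ.bind κ) ν +
          (klDiv (μ.bind κ) ρ + klDiv ((μ.bind κ) ⊗ₘ (κ†μ)) ((μ.bind κ) ⊗ₘ Q)) := by
        gcongr
        exact le_add_self
    _ = klDiv (μ.bind κ) ν + klDiv ((μ ⊗ₘ κ).map Prod.swap) (ρ ⊗ₘ Q) := by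
        rw [← compProd_posterior_eq_map_swap, ← klDiv_compProd_eq_add]

/-- The kernel whose transition law from `y` is that of `κ` tilted by `l y`, i.e. has density
proportional to `exp (l y ·)` with respect to `κ y`. -/
def tiltedKernel (κ : Kernel Y X) [IsSFiniteKernel κ] (l : Y → X → ℝ) : Kernel Y X :=
  κ.withDensity fun y x => ENNReal.ofReal (Real.exp (l y x) / ∫ z, Real.exp (l y z) ∂κ y)

variable {κ : Kernel Y X} {l : Y → X → ℝ}

lemma measurable_integral_exp [IsSFiniteKernel κ] (hl : Measurable (Function.uncurry l)) :
    Measurable fun y => ∫ z, Real.exp (l y z) ∂κ y :=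
  (hl.exp.stronglyMeasurable.integral_kernel_prod_right').measurable

lemma measurable_tilting_density [IsSFiniteKernel κ] (hl : Measurable (Function.uncurry l)) :
    Measurable (Function.uncurry fun y x =>
      ENNReal.ofReal (Real.exp (l y x) / ∫ z, Real.exp (l y z) ∂κ y)) :=
  (hl.exp.div ((measurable_integral_exp hl).comp measurable_fst)).ennreal_ofReal

lemma tiltedKernel_apply [IsSFiniteKernel κ] (hl : Measurable (Function.uncurry l)) (y : Y) :
    tiltedKernel κ l y = (κ y).tilted (l y) :=
  Kernel.withDensity_apply κ (measurable_tilting_density hl) y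

variable [IsMarkovKernel κ] {B : ℝ}

lemma integrable_exp_of_le (hl : Measurable (Function.uncurry l)) (hB : ∀ y x, l y x ≤ B) (y : Y) :
    Integrable (fun x => Real.exp (l y x)) (κ y) :=
  .of_bound (hl.of_uncurry_left.exp.aestronglyMeasurable) (Real.exp B)
    (ae_of_all _ fun x => by simpa using hB y x)

lemma isMarkovKernel_tiltedKernel (hl : Measurable (Function.uncurry l))
    (hB : ∀ y x, l y x ≤ B) : IsMarkovKernel (tiltedKernel κ l) where
  isProbabilityMeasure y := by
    rw [tiltedKernel_apply hl]
    exact isProbabilityMeasure_tilted (integrable_exp_of_le hl hB y)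

lemma integral_exp_le (hB : ∀ y x, l y x ≤ B) (y : Y) :
    ∫ x, Real.exp (l y x) ∂κ y ≤ Real.exp B := by
  have h := norm_integral_le_of_norm_le_const (μ := κ y) (f := fun x => Real.exp (l y x))
    (C := Real.exp B) (ae_of_all _ fun x => by simpa using hB y x)
  rw [probReal_univ, mul_one] at h
  exact (le_abs_self _).trans h

/-- The partition function of the tilting cancels against that of the reference measure. -/
lemma withDensity_compProd_tiltedKernel (π : Measure Y) [SFinite π] {f : Y → ℝ}
    (hf : Measurable f) (hf0 : ∀ y, 0 < f y) (hl : Measurable (Function.uncurry l))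
    (hB : ∀ y x, l y x ≤ B) :
    (π.withDensity fun y => ENNReal.ofReal (f y * ∫ z, Real.exp (l y z) ∂κ y)) ⊗ₘ tiltedKernel κ l =
      (π ⊗ₘ κ).withDensity fun q => ENNReal.ofReal (f q.1 * Real.exp (l q.1 q.2)) := by
  have := isMarkovKernel_tiltedKernel (κ := κ) hl hB
  have hw := measurable_tilting_density (κ := κ) hl
  have hZ : Measurable fun y => ENNReal.ofReal (f y * ∫ z, Real.exp (l y z) ∂κ y) :=
    (hf.mul (measurable_integral_exp hl)).ennreal_ofReal
  have hZ0 : ∀ y, 0 < ∫ z, Real.exp (l y z) ∂κ y := fun y =>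
    integral_exp_pos (integrable_exp_of_le hl hB y)
  refine Measure.ext_of_lintegral _ fun φ hφ => ?_
  rw [Measure.lintegral_compProd hφ, lintegral_withDensity_eq_lintegral_mul _ hZ
      hφ.lintegral_kernel_prod_right',
    lintegral_withDensity_eq_lintegral_mul _ (by fun_prop) hφ,
    Measure.lintegral_compProd (by fun_prop)]
  refine lintegral_congr fun y => ?_
  rw [tiltedKernel, Pi.mul_apply, Kernel.lintegral_withDensity _ hw _ (by fun_prop),
    ← lintegral_const_mul _ (by fun_prop)]
  refine lintegral_congr fun x => ?_
  rw [Pi.mul_apply, ← mul_assoc, ← ENNReal.ofReal_mul (mul_pos (hf0 y) (hZ0 y)).le, mul_assoc,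
    mul_div_cancel₀ _ (hZ0 y).ne']

end RelativeEntropy

section Reversible

variable {X : Type*} [MeasurableSpace X] {π : Measure X} {κ : Kernel X X} [IsMarkovKernel κ]

lemma map_swap_withDensity_compProd [SFinite π] (hκ : (π ⊗ₘ κ).map Prod.swap = π ⊗ₘ κ) {f : X → ℝ}
    (hf : Measurable f) :
    ((π.withDensity fun x => ENNReal.ofReal (f x)) ⊗ₘ κ).map Prod.swap =
      (π ⊗ₘ κ).withDensity fun q => ENNReal.ofReal (f q.2) := by
  refine Measure.ext_of_lintegral _ fun φ hφ => ?_
  rw [lintegral_withDensity_eq_lintegral_mul _ (by fun_prop) hφ, ← hκ,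
    lintegral_map hφ measurable_swap, lintegral_map (by fun_prop) measurable_swap,
    Measure.lintegral_compProd (by fun_prop), Measure.lintegral_compProd (by fun_prop),
    lintegral_withDensity_eq_lintegral_mul _ (by fun_prop) (by fun_prop)]
  refine lintegral_congr fun x => ?_
  simp only [Pi.mul_apply, Prod.snd_swap]
  rw [lintegral_const_mul _ (by fun_prop)]

lemma isFiniteMeasure_withDensity_mul_integral_exp {f : X → ℝ} (hf : Measurable f)
    (hf0 : ∀ x, 0 ≤ f x) [IsFiniteMeasure (π.withDensity fun x => ENNReal.ofReal (f x))]
    {l : X → X → ℝ} {B : ℝ} (hB : ∀ y x, l y x ≤ B) :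
    IsFiniteMeasure (π.withDensity fun y => ENNReal.ofReal (f y * ∫ z, Real.exp (l y z) ∂κ y)) := by
  have : IsFiniteMeasure (ENNReal.ofReal (Real.exp B) •
    π.withDensity fun x => ENNReal.ofReal (f x)) := Measure.smul_finite _ ENNReal.ofReal_ne_top
  refine isFiniteMeasure_of_le (ENNReal.ofReal (Real.exp B) •
    π.withDensity fun x => ENNReal.ofReal (f x)) ?_
  rw [← withDensity_smul _ (by fun_prop)]
  refine withDensity_mono (ae_of_all _ fun y => ?_)
  rw [Pi.smul_apply, smul_eq_mul, ← ENNReal.ofReal_mul (Real.exp_pos _).le, mul_comm (Real.exp B)]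
  exact ENNReal.ofReal_le_ofReal (mul_le_mul_of_nonneg_left (integral_exp_le hB y) (hf0 y))

/-- A Doob transform of a reversible kernel is compared with a tilting of the same kernel: the
time reversal of `κ` started from the density `f` is `κ` tilted by `log f`. -/
lemma klDiv_bind_tiltedKernel_le [StandardBorelSpace X] [Nonempty X] [SFinite π]
    (hκ : (π ⊗ₘ κ).map Prod.swap = π ⊗ₘ κ) {f : X → ℝ} (hf : Measurable f) (hf0 : ∀ x, 0 < f x)
    [IsFiniteMeasure (π.withDensity fun x => ENNReal.ofReal (f x))] {l : X → X → ℝ} {B : ℝ}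
    (hl : Measurable (Function.uncurry l)) (hB : ∀ y x, l y x ≤ B) (ν : Measure X)
    [IsFiniteMeasure ν] :
    klDiv (π.withDensity fun x => ENNReal.ofReal (f x)) (ν.bind (tiltedKernel κ l)) ≤
      klDiv ((π.withDensity fun x => ENNReal.ofReal (f x)).bind κ) ν +
        ∫⁻ y, ∫⁻ x, ENNReal.ofReal
          (f x * expDefect (Real.log (f x) - Real.log (f y) - l y x)) ∂κ y ∂π := by
  set μ := π.withDensity fun x => ENNReal.ofReal (f x)
  set ρ := π.withDensity fun y => ENNReal.ofReal (f y * ∫ z, Real.exp (l y z) ∂κ y)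
  have : IsMarkovKernel (tiltedKernel κ l) := isMarkovKernel_tiltedKernel hl hB
  have : IsFiniteMeasure ρ :=
    isFiniteMeasure_withDensity_mul_integral_exp hf (fun x => (hf0 x).le) hB
  have hρ : ρ ⊗ₘ tiltedKernel κ l = (π ⊗ₘ κ).withDensity
      fun q => ENNReal.ofReal (f q.1 * Real.exp (l q.1 q.2)) :=
    withDensity_compProd_tiltedKernel π hf hf0 hl hB
  have hμ : (μ ⊗ₘ κ).map Prod.swap = (π ⊗ₘ κ).withDensity fun q => ENNReal.ofReal (f q.2) :=
    map_swap_withDensity_compProd hκ hf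
  have : IsFiniteMeasure ((π ⊗ₘ κ).withDensity fun q =>
      ENNReal.ofReal (f q.1 * Real.exp (l q.1 q.2))) := by
    rw [← hρ]; infer_instance
  have : IsFiniteMeasure ((π ⊗ₘ κ).withDensity fun q => ENNReal.ofReal (f q.2)) := by
    rw [← hμ]; infer_instance
  have hl' : Measurable fun q : X × X => l q.1 q.2 := hl
  have hkl : klDiv ((μ ⊗ₘ κ).map Prod.swap) (ρ ⊗ₘ tiltedKernel κ l) = ∫⁻ q, ENNReal.ofReal
      (f q.2 * expDefect (Real.log (f q.2) - Real.log (f q.1) - l q.1 q.2)) ∂(π ⊗ₘ κ) := by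
    rw [hρ, hμ, klDiv_withDensity_withDensity (f := fun q : X × X => f q.2) (by fun_prop)
      (by fun_prop) (fun q => hf0 q.2) fun q => mul_pos (hf0 q.1) (Real.exp_pos _)]
    simp only [Real.log_mul (hf0 _).ne' (Real.exp_pos _).ne', Real.log_exp, sub_sub]
  calc klDiv μ (ν.bind (tiltedKernel κ l))
      ≤ klDiv (μ.bind κ) ν + klDiv ((μ ⊗ₘ κ).map Prod.swap) (ρ ⊗ₘ tiltedKernel κ l) :=
        klDiv_bind_le μ κ ν ρ (tiltedKernel κ l)
    _ = _ := by rw [hkl, Measure.lintegral_compProd (by fun_prop)]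

end Reversible

/-! ### Isotropic Gaussian measures -/

section Gaussian

variable {d : ℕ}

instance isProbabilityMeasure_isoGaussian (m : Vec d) (v : ℝ) :
    IsProbabilityMeasure (isoGaussian m v) := by
  unfold isoGaussian
  infer_instance

lemma posSemidef_smul_one {v : ℝ} (hv : 0 ≤ v) :
    (v • (1 : Matrix (Fin d) (Fin d) ℝ)).PosSemidef :=
  Matrix.PosSemidef.one.smul hv

lemma charFun_isoGaussian (m : Vec d) {v : ℝ} (hv : 0 ≤ v) (t : Vec d) :
    charFun (isoGaussian m v) t =
      Complex.exp ((inner ℝ t m : ℝ) * Complex.I - ((v * ‖t‖ ^ 2 / 2 : ℝ) : ℂ)) := by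
  rw [isoGaussian, charFun_multivariateGaussian (posSemidef_smul_one hv),
    EuclideanSpace.real_norm_sq_eq]
  simp [Matrix.smul_mulVec, dotProduct, pow_two, Finset.mul_sum, mul_left_comm]

lemma map_add_isoGaussian (m : Vec d) (v : ℝ) :
    (isoGaussian 0 v).map (m + ·) = isoGaussian m v := by
  simp only [isoGaussian, multivariateGaussian]
  rw [Measure.map_map (by fun_prop) (by fun_prop)]
  simp [Function.comp_def]

lemma map_smul_isoGaussian (a : ℝ) (m : Vec d) {v : ℝ} (hv : 0 ≤ v) :
    (isoGaussian m v).map (a • ·) = isoGaussian (a • m) (a ^ 2 * v) := by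
  refine Measure.ext_of_charFun (funext fun t => ?_)
  rw [charFun_map_smul, charFun_isoGaussian _ hv, charFun_isoGaussian _ (by positivity), norm_smul,
    mul_pow, real_inner_smul_left, real_inner_smul_right, Real.norm_eq_abs, sq_abs]
  ring_nf

lemma map_neg_isoGaussian {v : ℝ} (hv : 0 ≤ v) :
    (isoGaussian (0 : Vec d) v).map (fun u => -u) = isoGaussian 0 v := by
  simpa using map_smul_isoGaussian (-1) (0 : Vec d) hv

lemma isoGaussian_zero_right (m : Vec d) : isoGaussian m 0 = Measure.dirac m := by
  refine Measure.ext_of_charFun (funext fun t => ?_)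
  rw [charFun_isoGaussian _ le_rfl, charFun_dirac]
  simp [real_inner_comm]

lemma isoGaussian_conv_isoGaussian {v h : ℝ} (hv : 0 ≤ v) (hh : 0 ≤ h) :
    isoGaussian (0 : Vec d) v ∗ isoGaussian 0 h = isoGaussian 0 (v + h) := by
  refine Measure.ext_of_charFun (funext fun t => ?_)
  rw [charFun_conv, charFun_isoGaussian _ hv, charFun_isoGaussian _ hh,
    charFun_isoGaussian _ (by positivity), ← Complex.exp_add]
  congr 1
  rw [inner_zero_right]
  push_cast
  ring

lemma lintegral_isoGaussian (m : Vec d) (v : ℝ) {f : Vec d → ℝ≥0∞} (hf : Measurable f) :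
    ∫⁻ x, f x ∂(isoGaussian m v) = ∫⁻ u, f (m + u) ∂(isoGaussian 0 v) := by
  rw [← map_add_isoGaussian, lintegral_map hf (by fun_prop)]

lemma measurable_isoGaussian (v : ℝ) : Measurable fun m : Vec d => isoGaussian m v := by
  refine Measure.measurable_of_measurable_coe _ fun s hs => ?_
  simp_rw [← lintegral_indicator_one hs, lintegral_isoGaussian _ v (measurable_one.indicator hs)]
  exact Measurable.lintegral_prod_right' (f := fun q : Vec d × Vec d => s.indicator 1 (q.1 + q.2))
    ((measurable_one.indicator hs).comp (by fun_prop))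

/-- The heat kernel at time `v`, whose transition law from `m` is `N(m, v I)`. -/
def heatKernel (v : ℝ) : Kernel (Vec d) (Vec d) :=
  ⟨fun m => isoGaussian m v, measurable_isoGaussian v⟩

instance isMarkovKernel_heatKernel (v : ℝ) : IsMarkovKernel (heatKernel (d := d) v) :=
  ⟨fun m => isProbabilityMeasure_isoGaussian m v⟩

lemma bind_heatKernel (μ : Measure (Vec d)) (v : ℝ) :
    μ.bind (heatKernel v) = μ ∗ isoGaussian 0 v := by
  refine Measure.ext_of_lintegral _ fun f hf => ?_
  rw [Measure.lintegral_bind (by fun_prop) hf.aemeasurable, Measure.lintegral_conv hf]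
  exact lintegral_congr fun x => lintegral_isoGaussian x v hf

lemma map_swap_volume_compProd_heatKernel {v : ℝ} (hv : 0 ≤ v) :
    ((volume : Measure (Vec d)) ⊗ₘ heatKernel v).map Prod.swap = volume ⊗ₘ heatKernel v := by
  set γ : Measure (Vec d) := isoGaussian 0 v
  refine Measure.ext_of_lintegral _ fun f hf => ?_
  have key (g : Vec d × Vec d → ℝ≥0∞) (hg : Measurable g) :
      ∫⁻ q, g q ∂(volume ⊗ₘ heatKernel v) = ∫⁻ u, ∫⁻ y, g (y, y + u) ∂volume ∂γ := by
    rw [Measure.lintegral_compProd hg, lintegral_lintegral_swap (by fun_prop)]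
    exact lintegral_congr fun y => lintegral_isoGaussian y v (by fun_prop)
  calc ∫⁻ q, f q ∂((volume ⊗ₘ heatKernel v).map Prod.swap)
      = ∫⁻ u, ∫⁻ y, f (y + u, y) ∂volume ∂γ := by
        rw [lintegral_map hf measurable_swap, key _ (by fun_prop)]
        rfl
    _ = ∫⁻ u, ∫⁻ y, f (y, y + -u) ∂volume ∂γ := lintegral_congr fun u => by
        rw [← lintegral_add_right_eq_self (fun y => f (y, y + -u)) u]
        simp only [add_neg_cancel_right]
    _ = ∫⁻ u, ∫⁻ y, f (y, y + u) ∂volume ∂(γ.map fun u => -u) := by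
        rw [lintegral_map (by fun_prop) (by fun_prop)]
    _ = ∫⁻ q, f q ∂(volume ⊗ₘ heatKernel v) := by
        rw [map_neg_isoGaussian hv, key f hf]

lemma lintegral_inner_sq_isoGaussian {v : ℝ} (hv : 0 ≤ v) (e : Vec d) :
    ∫⁻ u, ENNReal.ofReal (inner ℝ e u ^ 2) ∂(isoGaussian (0 : Vec d) v) =
      ENNReal.ofReal (v * ‖e‖ ^ 2) := by
  have : IsGaussian (isoGaussian (0 : Vec d) v) := by
    unfold isoGaussian
    infer_instance
  have hmean : ∫ u, inner ℝ e u ∂(isoGaussian (0 : Vec d) v) = 0 := by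
    rw [integral_inner IsGaussian.integrable_fun_id]
    simp [isoGaussian]
  have hvar : Var[fun u => inner ℝ e u; isoGaussian (0 : Vec d) v] = v * ‖e‖ ^ 2 := by
    rw [← covarianceBilin_self IsGaussian.memLp_two_id, isoGaussian,
      covarianceBilin_multivariateGaussian (posSemidef_smul_one hv), EuclideanSpace.real_norm_sq_eq]
    simp [Matrix.smul_mulVec, dotProduct, pow_two, Finset.mul_sum, mul_left_comm]
  have hL2 : MemLp (fun u => inner ℝ e u) 2 (isoGaussian (0 : Vec d) v) :=
    IsGaussian.memLp_dual _ (innerSL ℝ e) 2 (by simp)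
  rw [← hvar, ofReal_variance hL2, evariance, hmean]
  refine lintegral_congr fun u => ?_
  rw [sub_zero, ← enorm_pow, Real.enorm_of_nonneg (sq_nonneg _)]

/-- The density of `N(0, v I)` with respect to Lebesgue measure. -/
def isoGaussianPDFReal (v : ℝ) (x : Vec d) : ℝ :=
  (Real.sqrt (2 * Real.pi * v) ^ d)⁻¹ * Real.exp (-‖x‖ ^ 2 / (2 * v))

lemma isoGaussianPDFReal_pos {v : ℝ} (hv : 0 < v) (x : Vec d) : 0 < isoGaussianPDFReal v x := by
  unfold isoGaussianPDFReal
  positivity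

@[fun_prop]
lemma continuous_isoGaussianPDFReal (v : ℝ) : Continuous (isoGaussianPDFReal (d := d) v) := by
  unfold isoGaussianPDFReal
  fun_prop

lemma sqrt_pow_eq_rpow {x : ℝ} (hx : 0 ≤ x) (n : ℕ) : Real.sqrt x ^ n = x ^ ((n : ℝ) / 2) := by
  rw [Real.sqrt_eq_rpow, ← Real.rpow_natCast, ← Real.rpow_mul hx, one_div_mul_eq_div]

lemma integral_isoGaussianPDFReal_mul_cexp {v : ℝ} (hv : 0 < v) (t : Vec d) :
    ∫ x, (isoGaussianPDFReal v x : ℂ) * Complex.exp ((inner ℝ x t : ℝ) * Complex.I) =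
      Complex.exp (-((v * ‖t‖ ^ 2 / 2 : ℝ) : ℂ)) := by
  have hv' : (v : ℂ) ≠ 0 := by exact_mod_cast hv.ne'
  have hpos : 0 < 2 * Real.pi * v := by positivity
  have hpdf (x : Vec d) : (isoGaussianPDFReal v x : ℂ) *
      Complex.exp ((inner ℝ x t : ℝ) * Complex.I) =
      (((2 * Real.pi * v) ^ ((d : ℝ) / 2))⁻¹ : ℝ) *
        Complex.exp (-((1 / (2 * v) : ℝ) : ℂ) * (‖x‖ : ℂ) ^ 2 + Complex.I * (inner ℝ t x : ℝ)) := by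
    rw [isoGaussianPDFReal, ← sqrt_pow_eq_rpow hpos.le, Complex.ofReal_mul, mul_assoc,
      Complex.ofReal_exp, ← Complex.exp_add, real_inner_comm]
    congr 2
    push_cast
    ring
  have hconst : ((Real.pi : ℂ) / ((1 / (2 * v) : ℝ) : ℂ)) ^ ((d : ℂ) / 2) =
      (((2 * Real.pi * v) ^ ((d : ℝ) / 2) : ℝ) : ℂ) := by
    rw [Complex.ofReal_cpow hpos.le]
    push_cast
    congr 1
    field_simp
  simp_rw [hpdf]
  rw [integral_const_mul, GaussianFourier.integral_cexp_neg_mul_sq_norm_add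
      (by rw [Complex.ofReal_re]; positivity),
    finrank_euclideanSpace, Fintype.card_fin, hconst, ← mul_assoc, ← Complex.ofReal_mul,
    inv_mul_cancel₀ (by positivity), Complex.ofReal_one, one_mul, Complex.I_sq]
  congr 1
  push_cast
  field_simp
  norm_num

lemma integral_isoGaussianPDFReal {v : ℝ} (hv : 0 < v) :
    ∫ x : Vec d, isoGaussianPDFReal v x = 1 := by
  have h := integral_isoGaussianPDFReal_mul_cexp hv (0 : Vec d)
  simp only [inner_zero_right, Complex.ofReal_zero, zero_mul, Complex.exp_zero, mul_one, norm_zero,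
    ne_eq, OfNat.ofNat_ne_zero, not_false_eq_true, zero_pow, mul_zero, zero_div, neg_zero] at h
  exact_mod_cast integral_complex_ofReal.symm.trans h

lemma lintegral_isoGaussianPDFReal {v : ℝ} (hv : 0 < v) :
    ∫⁻ x : Vec d, ENNReal.ofReal (isoGaussianPDFReal v x) = 1 := by
  rw [← ofReal_integral_eq_lintegral_ofReal, integral_isoGaussianPDFReal hv, ENNReal.ofReal_one]
  · exact .of_integral_ne_zero (by rw [integral_isoGaussianPDFReal hv]; exact one_ne_zero)
  · exact ae_of_all _ fun x => (isoGaussianPDFReal_pos hv x).le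

lemma isoGaussian_zero_eq_withDensity {v : ℝ} (hv : 0 < v) :
    isoGaussian (0 : Vec d) v =
      volume.withDensity fun x => ENNReal.ofReal (isoGaussianPDFReal v x) := by
  have : IsFiniteMeasure (volume.withDensity
      fun x : Vec d => ENNReal.ofReal (isoGaussianPDFReal v x)) :=
    isFiniteMeasure_withDensity (by simp [lintegral_isoGaussianPDFReal hv])
  refine Measure.ext_of_charFun (funext fun t => ?_)
  rw [charFun_isoGaussian _ hv.le, charFun_apply, integral_withDensity_eq_integral_toReal_smul
    (by fun_prop) (ae_of_all _ fun _ => ENNReal.ofReal_lt_top), inner_zero_right,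
    Complex.ofReal_zero, zero_mul, zero_sub, ← integral_isoGaussianPDFReal_mul_cexp hv t]
  refine integral_congr_ae (ae_of_all _ fun x => ?_)
  dsimp only
  rw [ENNReal.toReal_ofReal (isoGaussianPDFReal_pos hv x).le, Complex.real_smul]

lemma lintegral_isoGaussian_zero {v : ℝ} (hv : 0 < v) {f : Vec d → ℝ≥0∞} (hf : Measurable f) :
    ∫⁻ u, f u ∂(isoGaussian 0 v) = ∫⁻ u, ENNReal.ofReal (isoGaussianPDFReal v u) * f u := by
  rw [isoGaussian_zero_eq_withDensity hv, lintegral_withDensity_eq_lintegral_mul _ (by fun_prop) hf]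
  rfl

lemma isoGaussianPDFReal_mul_exp_mul_sq_norm {v c : ℝ} (hv : 0 < v) (hcv : 2 * c * v < 1)
    (u : Vec d) :
    isoGaussianPDFReal v u * Real.exp (c * ‖u‖ ^ 2) =
      (Real.sqrt (1 - 2 * c * v) ^ d)⁻¹ * isoGaussianPDFReal (v / (1 - 2 * c * v)) u := by
  have hy : 0 < 1 - 2 * c * v := sub_pos.2 hcv
  rw [isoGaussianPDFReal, isoGaussianPDFReal, ← mul_assoc, ← mul_inv, ← mul_pow,
    ← Real.sqrt_mul hy.le, mul_assoc, ← Real.exp_add]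
  congr 3
  · rw [mul_comm (1 - 2 * c * v), mul_assoc (2 * Real.pi) (v / (1 - 2 * c * v)),
      div_mul_cancel₀ _ hy.ne']
  · field_simp
    ring

lemma lintegral_exp_mul_sq_norm_isoGaussian {v c : ℝ} (hv : 0 < v) (hcv : 2 * c * v < 1) :
    ∫⁻ u, ENNReal.ofReal (Real.exp (c * ‖u‖ ^ 2)) ∂(isoGaussian (0 : Vec d) v) =
      ENNReal.ofReal ((Real.sqrt (1 - 2 * c * v) ^ d)⁻¹) := by
  have hv' : 0 < v / (1 - 2 * c * v) := div_pos hv (sub_pos.2 hcv)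
  rw [lintegral_isoGaussian_zero hv (by fun_prop)]
  simp_rw [← ENNReal.ofReal_mul (isoGaussianPDFReal_pos hv _).le,
    isoGaussianPDFReal_mul_exp_mul_sq_norm hv hcv, ENNReal.ofReal_mul (inv_nonneg.2 (by positivity :
      (0 : ℝ) ≤ Real.sqrt (1 - 2 * c * v) ^ d))]
  rw [lintegral_const_mul _ (by fun_prop), lintegral_isoGaussianPDFReal hv', mul_one]

lemma lintegral_exp_mul_sq_norm_isoGaussian_le {v c : ℝ} (hv : 0 < v) (hc : 0 ≤ c)
    (hcv : 2 * c * v ≤ 1 / 2) :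
    ∫⁻ u, ENNReal.ofReal (Real.exp (c * ‖u‖ ^ 2)) ∂(isoGaussian (0 : Vec d) v) ≤
      ENNReal.ofReal (Real.exp (2 * c * v * d)) := by
  set x := 2 * c * v
  have hx : 0 ≤ x := by positivity
  have hsqrt : Real.exp (-x) ≤ Real.sqrt (1 - x) := by
    refine Real.le_sqrt_of_sq_le ?_
    have h2 : Real.exp (-(2 * x)) * (1 + 2 * x) ≤ 1 := by
      rw [Real.exp_neg, inv_mul_le_one₀ (Real.exp_pos _), add_comm]
      exact Real.add_one_le_exp _
    rw [← Real.exp_nat_mul, Nat.cast_two, mul_neg]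
    nlinarith [Real.exp_pos (-(2 * x))]
  rw [lintegral_exp_mul_sq_norm_isoGaussian hv (by linarith)]
  refine ENNReal.ofReal_le_ofReal ?_
  calc (Real.sqrt (1 - x) ^ d)⁻¹ ≤ (Real.exp (-x) ^ d)⁻¹ := by gcongr
    _ = Real.exp (x * d) := by rw [← Real.exp_nat_mul, ← Real.exp_neg]; ring_nf

end Gaussian

/-! ### Gaussian mixtures -/

section GaussMix

variable {d : ℕ}

/-- The gradient of the density of `N(0, v I)`. -/
def isoGaussianGrad (v : ℝ) (x : Vec d) : Vec d := -(isoGaussianPDFReal v x / v) • x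

@[fun_prop]
lemma continuous_isoGaussianGrad (v : ℝ) : Continuous (isoGaussianGrad (d := d) v) := by
  unfold isoGaussianGrad
  fun_prop

lemma hasGradientAt_isoGaussianPDFReal (v : ℝ) (x : Vec d) :
    HasGradientAt (isoGaussianPDFReal v) (isoGaussianGrad v x) x := by
  have hexponent : HasFDerivAt (fun x : Vec d => -‖x‖ ^ 2 / (2 * v))
      ((-(2 * v)⁻¹) • ((2 : ℝ) • innerSL ℝ x)) x := by
    have h := (hasStrictFDerivAt_norm_sq x).hasFDerivAt.const_mul (-(2 * v)⁻¹)
    simp only [two_nsmul, ← two_smul ℝ] at h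
    exact h.congr_of_eventuallyEq (.of_forall fun y => by ring)
  refine (hexponent.exp.const_mul ((Real.sqrt (2 * Real.pi * v) ^ d)⁻¹)).congr_fderiv ?_
  ext y
  simp only [isoGaussianGrad, isoGaussianPDFReal, map_smul, FunLike.coe_smul, Pi.smul_apply,
    smul_eq_mul, innerSL_apply_apply, InnerProductSpace.toDual_apply_apply]
  ring

lemma isoGaussianPDFReal_le {v : ℝ} (hv : 0 ≤ v) (x : Vec d) :
    isoGaussianPDFReal v x ≤ (Real.sqrt (2 * Real.pi * v) ^ d)⁻¹ := by
  refine mul_le_of_le_one_right (by positivity) (Real.exp_le_one_iff.2 ?_)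
  exact div_nonpos_of_nonpos_of_nonneg (neg_nonpos.2 (sq_nonneg _)) (by positivity)

lemma norm_isoGaussianGrad_le {v : ℝ} (hv : 0 < v) (x : Vec d) :
    ‖isoGaussianGrad v x‖ ≤ (Real.sqrt (2 * Real.pi * v) ^ d)⁻¹ * ((1 + v) / v) := by
  have hyoung : ‖x‖ ≤ ‖x‖ ^ 2 / (2 * v) + v / 2 := by
    have h : ‖x‖ ^ 2 / (2 * v) + v / 2 - ‖x‖ = (‖x‖ - v) ^ 2 / (2 * v) := by field_simp; ring
    have : 0 ≤ (‖x‖ - v) ^ 2 / (2 * v) := by positivity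
    linarith
  have hexp : Real.exp (-‖x‖ ^ 2 / (2 * v)) * ‖x‖ ≤ 1 + v := by
    rw [neg_div, Real.exp_neg, inv_mul_le_iff₀ (Real.exp_pos _)]
    nlinarith [Real.add_one_le_exp (‖x‖ ^ 2 / (2 * v)),
      (by positivity : 0 ≤ ‖x‖ ^ 2 / (2 * v))]
  rw [isoGaussianGrad, norm_smul, Real.norm_eq_abs, abs_neg,
    abs_of_pos (div_pos (isoGaussianPDFReal_pos hv x) hv), isoGaussianPDFReal]
  calc _ = (Real.sqrt (2 * Real.pi * v) ^ d)⁻¹ *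
        ((Real.exp (-‖x‖ ^ 2 / (2 * v)) * ‖x‖) / v) := by ring
    _ ≤ _ := by gcongr

lemma exp_mul_isoGaussianPDFReal_add_le {v : ℝ} (hv : 0 < v) (x w : Vec d) (m : ℝ) :
    Real.exp m * (isoGaussianPDFReal v x * (1 - m) + inner ℝ w (isoGaussianGrad v x)) ≤
      Real.exp (‖w‖ ^ 2 / (2 * v)) * isoGaussianPDFReal v (x + w) := by
  set a : ℝ := -(inner ℝ w x / v)
  have hshift : Real.exp (‖w‖ ^ 2 / (2 * v)) * isoGaussianPDFReal v (x + w) =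
      Real.exp m * (isoGaussianPDFReal v x * Real.exp (a - m)) := by
    unfold isoGaussianPDFReal
    rw [add_comm x, norm_add_sq_real, mul_left_comm, ← Real.exp_add,
      mul_assoc (Real.sqrt (2 * Real.pi * v) ^ d)⁻¹, ← Real.exp_add, mul_left_comm, ← Real.exp_add]
    congr 2
    simp only [a]
    field_simp
    ring
  rw [hshift, isoGaussianGrad, real_inner_smul_right]
  refine mul_le_mul_of_nonneg_left ?_ (Real.exp_pos _).le
  calc _ = isoGaussianPDFReal v x * (a - m + 1) := by simp only [a]; ring
    _ ≤ _ := mul_le_mul_of_nonneg_left (Real.add_one_le_exp _) (isoGaussianPDFReal_pos hv _).le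

/-- The density of `P ∗ N(0, v I)`. -/
def gaussMix (P : Measure (Vec d)) (v : ℝ) (x : Vec d) : ℝ := ∫ y, isoGaussianPDFReal v (x - y) ∂P

/-- The score of `P ∗ N(0, v I)`. -/
def gaussMixScore (P : Measure (Vec d)) (v : ℝ) (x : Vec d) : Vec d :=
  gradient (fun y => Real.log (gaussMix P v y)) x

variable (P : Measure (Vec d)) [IsFiniteMeasure P] {v : ℝ}

lemma integrable_isoGaussianPDFReal_sub (hv : 0 < v) (x : Vec d) :
    Integrable (fun y => isoGaussianPDFReal v (x - y)) P :=
  .of_bound (by fun_prop) _ (ae_of_all _ fun y => by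
    rw [Real.norm_of_nonneg (isoGaussianPDFReal_pos hv _).le]
    exact isoGaussianPDFReal_le hv.le _)

lemma integrable_isoGaussianGrad_sub (hv : 0 < v) (x : Vec d) :
    Integrable (fun y => isoGaussianGrad v (x - y)) P :=
  .of_bound (by fun_prop) _ (ae_of_all _ fun _ => norm_isoGaussianGrad_le hv _)

lemma hasGradientAt_gaussMix (hv : 0 < v) (x : Vec d) :
    HasGradientAt (gaussMix P v) (∫ y, isoGaussianGrad v (x - y) ∂P) x := by
  have h := hasFDerivAt_integral_of_dominated_of_fderiv_le (μ := P) (𝕜 := ℝ)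
    (F := fun x y => isoGaussianPDFReal v (x - y)) (x₀ := x) (s := Set.univ)
    (F' := fun x y => innerSL ℝ (isoGaussianGrad v (x - y)))
    (bound := fun _ => (Real.sqrt (2 * Real.pi * v) ^ d)⁻¹ * ((1 + v) / v)) Filter.univ_mem
    (.of_forall fun x => by fun_prop) (integrable_isoGaussianPDFReal_sub P hv x) (by fun_prop)
    (ae_of_all _ fun y x _ => by rw [innerSL_apply_norm]; exact norm_isoGaussianGrad_le hv _)
    (integrable_const _)
    (ae_of_all _ fun y x _ =>
      (hasFDerivAt_comp_sub y).2 (hasGradientAt_isoGaussianPDFReal v (x - y)))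
  rwa [ContinuousLinearMap.integral_comp_comm _ (integrable_isoGaussianGrad_sub P hv x)] at h

lemma continuous_gaussMix (hv : 0 < v) : Continuous (gaussMix P v) :=
  continuous_iff_continuousAt.2 fun x => (hasGradientAt_gaussMix P hv x).continuousAt

lemma conv_isoGaussian_eq_withDensity (hv : 0 < v) :
    P ∗ isoGaussian 0 v = volume.withDensity fun x => ENNReal.ofReal (gaussMix P v x) := by
  refine Measure.ext_of_lintegral _ fun f hf => ?_
  have hmeas : Measurable fun q : Vec d × Vec d =>
      ENNReal.ofReal (isoGaussianPDFReal v (q.2 - q.1)) * f q.2 := by fun_prop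
  have hgauss (y : Vec d) : ∫⁻ u, f (y + u) ∂isoGaussian 0 v =
      ∫⁻ x, ENNReal.ofReal (isoGaussianPDFReal v (x - y)) * f x := by
    rw [lintegral_isoGaussian_zero hv (by fun_prop),
      ← lintegral_add_left_eq_self (fun x => ENNReal.ofReal (isoGaussianPDFReal v (x - y)) * f x) y]
    simp only [add_sub_cancel_left]
  rw [Measure.lintegral_conv hf, lintegral_withDensity_eq_lintegral_mul _
    (continuous_gaussMix P hv).measurable.ennreal_ofReal hf]
  simp_rw [hgauss]
  rw [lintegral_lintegral_swap hmeas.aemeasurable]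
  refine lintegral_congr fun x => ?_
  rw [lintegral_mul_const _ (by fun_prop), Pi.mul_apply, gaussMix,
    ofReal_integral_eq_lintegral_ofReal (integrable_isoGaussianPDFReal_sub P hv x)
      (ae_of_all _ fun y => (isoGaussianPDFReal_pos hv _).le)]

variable [NeZero P]

lemma gaussMix_pos (hv : 0 < v) (x : Vec d) : 0 < gaussMix P v x :=
  (integral_pos_iff_support_of_nonneg (fun _ => (isoGaussianPDFReal_pos hv _).le)
    (integrable_isoGaussianPDFReal_sub P hv x)).2 (by
      rw [Function.support_eq_univ fun y => (isoGaussianPDFReal_pos hv (x - y)).ne']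
      exact NeZero.pos _)

lemma gaussMixScore_eq (hv : 0 < v) (x : Vec d) :
    gaussMixScore P v x = (gaussMix P v x)⁻¹ • ∫ y, isoGaussianGrad v (x - y) ∂P := by
  refine HasGradientAt.gradient ?_
  rw [hasGradientAt_iff_hasFDerivAt, map_smul]
  exact (hasGradientAt_gaussMix P hv x).hasFDerivAt.log (gaussMix_pos P hv x).ne'

lemma hasGradientAt_log_gaussMix (hv : 0 < v) (x : Vec d) :
    HasGradientAt (fun y => Real.log (gaussMix P v y)) (gaussMixScore P v x) x :=
  (((hasGradientAt_gaussMix P hv x).hasFDerivAt.log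
    (gaussMix_pos P hv x).ne').differentiableAt).hasGradientAt

lemma continuous_gaussMixScore (hv : 0 < v) : Continuous (gaussMixScore P v) := by
  rw [funext (gaussMixScore_eq P hv)]
  refine ((continuous_gaussMix P hv).inv₀ fun x => (gaussMix_pos P hv x).ne').smul ?_
  exact continuous_of_dominated (fun x => by fun_prop)
    (fun x => ae_of_all _ fun y => norm_isoGaussianGrad_le hv _) (integrable_const _)
    (ae_of_all _ fun y => by fun_prop)

lemma log_gaussMix_sub_eq_integral (hv : 0 < v) (y u : Vec d) :
    Real.log (gaussMix P v (y + u)) - Real.log (gaussMix P v y) =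
      ∫ r in Set.Icc (0 : ℝ) 1, inner ℝ u (gaussMixScore P v (y + r • u)) := by
  have hscore := continuous_gaussMixScore P hv
  have hderiv : ∀ r ∈ Set.uIcc (0 : ℝ) 1,
      HasDerivAt (fun r : ℝ => Real.log (gaussMix P v (y + r • u)))
        (inner ℝ u (gaussMixScore P v (y + r • u))) r := by
    intro r _
    have hline : HasDerivAt (fun r : ℝ => y + r • u) u r := by
      simpa using ((hasDerivAt_id r).smul_const u).const_add y
    rw [real_inner_comm]
    exact (hasGradientAt_log_gaussMix P hv (y + r • u)).hasFDerivAt.comp_hasDerivAt r hline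
  have h := intervalIntegral.integral_eq_sub_of_hasDerivAt hderiv
    (Continuous.intervalIntegrable (by fun_prop) _ _)
  rw [integral_Icc_eq_integral_Ioc, ← intervalIntegral.integral_of_le zero_le_one, h]
  simp

/-- Equivalently, `log (gaussMix P v) + ‖·‖² / (2 v)` is convex: it is, up to a constant, the
cumulant generating function of a tilt of `P`. -/
lemma log_gaussMix_add_inner_score_le (hv : 0 < v) (z w : Vec d) :
    Real.log (gaussMix P v z) + inner ℝ w (gaussMixScore P v z) ≤
      Real.log (gaussMix P v (z + w)) + ‖w‖ ^ 2 / (2 * v) := by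
  set m : ℝ := inner ℝ w (gaussMixScore P v z) with hm
  have hp := gaussMix_pos P hv
  have hpdf := integrable_isoGaussianPDFReal_sub P hv
  have hgrad := (integrable_isoGaussianGrad_sub P hv z).const_inner (𝕜 := ℝ) w
  have hmz : ∫ y, inner ℝ w (isoGaussianGrad v (z - y)) ∂P = gaussMix P v z * m := by
    rw [hm, gaussMixScore_eq P hv,
      integral_inner (𝕜 := ℝ) (integrable_isoGaussianGrad_sub P hv z),
      real_inner_smul_right, mul_inv_cancel_left₀ (hp z).ne']
  have hle : Real.exp m * gaussMix P v z ≤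
      Real.exp (‖w‖ ^ 2 / (2 * v)) * gaussMix P v (z + w) := by
    have h := integral_mono ((((hpdf z).mul_const (1 - m)).add hgrad).const_mul (Real.exp m))
      ((hpdf (z + w)).const_mul (Real.exp (‖w‖ ^ 2 / (2 * v)))) fun y => by
        simpa only [Pi.add_apply, add_sub_right_comm] using
          exp_mul_isoGaussianPDFReal_add_le hv (z - y) w m
    simp only [Pi.add_apply] at h
    rw [integral_const_mul, integral_const_mul, integral_add ((hpdf z).mul_const _) hgrad,
      integral_mul_const, hmz, ← gaussMix, ← gaussMix] at h
    linarith
  have h := Real.log_le_log (mul_pos (Real.exp_pos _) (hp z)) hle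
  rw [Real.log_mul (Real.exp_pos _).ne' (hp _).ne', Real.log_mul (Real.exp_pos _).ne' (hp _).ne',
    Real.log_exp, Real.log_exp] at h
  linarith

/-- The two tangents at `z + w` in the directions `-w` and `(m - 1) w`. -/
lemma mul_log_gaussMix_sub_le (hv : 0 < v) (z w : Vec d) {m : ℝ} (hm : 1 ≤ m) :
    m * (Real.log (gaussMix P v (z + w)) - Real.log (gaussMix P v z)) ≤
      Real.log (gaussMix P v (z + m • w)) - Real.log (gaussMix P v z) +
        m * (m - 1) * (‖w‖ ^ 2 / (2 * v)) := by
  have hback := log_gaussMix_add_inner_score_le P hv (z + w) (-w)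
  have hforth := log_gaussMix_add_inner_score_le P hv (z + w) ((m - 1) • w)
  rw [add_neg_cancel_right, norm_neg, inner_neg_left] at hback
  rw [show z + w + (m - 1) • w = z + m • w by module, norm_smul, real_inner_smul_left, mul_pow,
    Real.norm_eq_abs, sq_abs, mul_div_assoc] at hforth
  linarith [mul_le_mul_of_nonneg_left hback (sub_nonneg.2 hm)]

end GaussMix

/-! ### The forward process -/

section Forward

variable {d : ℕ} {α η : ℕ → ℝ} {t : ℕ}

lemma noiseVar_nonneg (hη : ∀ s < t, 0 ≤ η s) : 0 ≤ noiseVar α η t := by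
  induction t with
  | zero => exact le_rfl
  | succ t ih =>
    have hprev := ih fun s hs => hη s (hs.trans t.lt_succ_self)
    have hstep := hη t t.lt_succ_self
    rw [noiseVar]
    positivity

lemma noiseVar_succ_pos (hα : α t ≠ 0) (hη : ∀ s ≤ t, 0 < η s) : 0 < noiseVar α η (t + 1) := by
  have hprev : 0 ≤ noiseVar α η t := noiseVar_nonneg fun s hs => (hη s hs.le).le
  have hstep := hη t le_rfl
  rw [noiseVar]
  positivity

lemma map_smul_conv {E : Type*} [NormedAddCommGroup E] [NormedSpace ℝ E] [MeasurableSpace E]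
    [BorelSpace E] [SecondCountableTopology E] (μ ν : Measure E) [SFinite μ] [SFinite ν] (a : ℝ) :
    (μ ∗ ν).map (a • ·) = μ.map (a • ·) ∗ ν.map (a • ·) :=
  Measure.map_conv_continuousLinearMap (a • ContinuousLinearMap.id ℝ E)

lemma bind_isoGaussian_smul (μ : Measure (Vec d)) (a : ℝ) {h : ℝ} (hh : 0 ≤ h) :
    (μ.bind fun x => isoGaussian (a • x) (a ^ 2 * h)) = (μ ∗ isoGaussian 0 h).map (a • ·) := by
  refine Measure.ext_of_lintegral _ fun f hf => ?_
  have hmeas : Measurable fun x : Vec d => isoGaussian (a • x) (a ^ 2 * h) :=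
    (measurable_isoGaussian _).comp (measurable_const_smul a)
  rw [Measure.lintegral_bind hmeas.aemeasurable hf.aemeasurable, lintegral_map hf (by fun_prop),
    Measure.lintegral_conv (by fun_prop)]
  refine lintegral_congr fun x => ?_
  rw [← map_smul_isoGaussian a x hh, lintegral_map hf (by fun_prop),
    lintegral_isoGaussian x h (by fun_prop)]

lemma score_eq_gaussMixScore (pdata : Measure (Vec d)) :
    score α η pdata t = gaussMixScore (pdata.map (scale α t • ·)) (noiseVar α η t) := by
  have hdensity : forwardDensity α η pdata t =
      gaussMix (pdata.map (scale α t • ·)) (noiseVar α η t) := by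
    ext1 x
    rw [gaussMix, integral_map (by fun_prop) (by fun_prop)]
    rfl
  ext1 x
  rw [score, gaussMixScore, hdensity]

variable (pdata : Measure (Vec d)) [IsFiniteMeasure pdata]

lemma forwardLaw_eq_conv (hη : ∀ s < t, 0 ≤ η s) :
    forwardLaw α η pdata t = pdata.map (scale α t • ·) ∗ isoGaussian 0 (noiseVar α η t) := by
  induction t with
  | zero => simp [forwardLaw, scale, noiseVar, isoGaussian_zero_right]
  | succ t ih =>
    have hη' : ∀ s < t, 0 ≤ η s := fun s hs => hη s (hs.trans t.lt_succ_self)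
    have hprev : 0 ≤ noiseVar α η t := noiseVar_nonneg hη'
    have hstep := hη t t.lt_succ_self
    rw [forwardLaw, ih hη', bind_isoGaussian_smul _ _ hstep, Measure.conv_assoc,
      isoGaussian_conv_isoGaussian hprev hstep, map_smul_conv,
      map_smul_isoGaussian _ _ (add_nonneg hprev hstep), smul_zero, Measure.map_map (by fun_prop)
      (by fun_prop), noiseVar]
    simp only [Function.comp_def, smul_smul, scale, Finset.prod_range_succ, mul_comm]

lemma forwardLaw_eq_withDensity (hη : ∀ s < t, 0 ≤ η s) (hv : 0 < noiseVar α η t) :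
    forwardLaw α η pdata t = volume.withDensity fun x =>
      ENNReal.ofReal (gaussMix (pdata.map (scale α t • ·)) (noiseVar α η t) x) := by
  rw [forwardLaw_eq_conv pdata hη, conv_isoGaussian_eq_withDensity _ hv]

end Forward

/-! ### First-order rejection sampling -/

section Fors

variable {d : ℕ} {B : ℝ}

lemma lintegral_pow_poissonMeasure (r : ℝ≥0) {m : ℝ} (hm : 0 ≤ m) :
    ∫⁻ J, ENNReal.ofReal (m ^ J) ∂(poissonMeasure r) = ENNReal.ofReal (Real.exp (r * m - r)) := by
  lift m to ℝ≥0 using hm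
  have h := (hasSum_one_poissonMeasure (r * m)).mul_left (Real.exp (r * m - r))
  rw [mul_one] at h
  rw [poissonMeasure, lintegral_sum_measure, ← h.tsum_eq,
    ENNReal.ofReal_tsum_of_nonneg (fun n => by positivity) h.summable]
  refine tsum_congr fun n => ?_
  rw [lintegral_smul_measure, lintegral_dirac, smul_eq_mul, ← ENNReal.ofReal_mul (by positivity)]
  congr 1
  rw [show -(r : ℝ) = (r * m - r) + -(r * m : ℝ≥0) by push_cast; ring, Real.exp_add,
    NNReal.coe_mul, mul_pow]
  ring

lemma lintegral_prod_pi {W : Measure ℝ} [SigmaFinite W] {f : ℝ → ℝ} (hf : Integrable f W)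
    (hf0 : 0 ≤ᵐ[W] f) (J : ℕ) :
    ∫⁻ w : Fin J → ℝ, ENNReal.ofReal (∏ j, f (w j)) ∂(Measure.pi fun _ => W) =
      ENNReal.ofReal ((∫ w, f w ∂W) ^ J) := by
  have hcoord : ∀ᵐ w ∂(Measure.pi fun _ : Fin J => W), ∀ j, 0 ≤ f (w j) :=
    ae_all_iff.2 fun j => (Measure.quasiMeasurePreserving_eval (fun _ : Fin J => W) j).ae hf0
  rw [← ofReal_integral_eq_lintegral_ofReal (Integrable.fintype_prod fun _ => hf)
    (hcoord.mono fun w hw => Finset.prod_nonneg fun j _ => hw j),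
    integral_fintype_prod_eq_pow, Fintype.card_fin]

variable {W : Measure ℝ} [IsProbabilityMeasure W]

lemma abs_integral_id_le_of_ae_mem_Icc (hW : ∀ᵐ w ∂W, w ∈ Set.Icc (-B) B) :
    |∫ w, w ∂W| ≤ B := by
  simpa using norm_integral_le_of_norm_le_const (f := fun w => w) (hW.mono fun w hw => abs_le.2 hw)

lemma forsAccept_eq (hB : 0 < B) (hW : ∀ᵐ w ∂W, w ∈ Set.Icc (-B) B) :
    forsAccept B W = ENNReal.ofReal (Real.exp (∫ w, w ∂W - B)) := by
  have hint : Integrable (fun w : ℝ => w) W := .of_bound (by fun_prop) B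
    (hW.mono fun w hw => abs_le.2 hw)
  have hmean : ∫ w, (B + w) / (2 * B) ∂W = (B + ∫ w, w ∂W) / (2 * B) := by
    rw [integral_div, integral_add (integrable_const _) hint, integral_const, probReal_univ,
      one_smul]
  have hnonneg : 0 ≤ᵐ[W] fun w => (B + w) / (2 * B) :=
    hW.mono fun w hw => div_nonneg (neg_le_iff_add_nonneg'.1 hw.1) (by positivity)
  unfold forsAccept
  simp_rw [lintegral_prod_pi (f := fun w => (B + w) / (2 * B))
    (((integrable_const B).add hint).div_const _) hnonneg]
  rw [lintegral_pow_poissonMeasure _ (integral_nonneg_of_ae hnonneg), hmean,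
    Real.coe_toNNReal _ (by positivity)]
  congr 2
  field_simp
  ring

lemma forsLaw_eq_smul_forsHit (q : Measure (Vec d)) [IsProbabilityMeasure q]
    {W : Vec d → Measure ℝ} (hm : Measurable fun x => forsAccept B (W x))
    (hle : ∀ x, forsAccept B (W x) ≤ 1) :
    forsLaw B q W = (∫⁻ x, forsAccept B (W x) ∂q)⁻¹ • forsHit B q W := by
  have hhit : ∫⁻ x, forsAccept B (W x) ∂q ≤ 1 := (lintegral_mono hle).trans (by simp)
  have hmiss : forsMiss B q W = 1 - ∫⁻ x, forsAccept B (W x) ∂q := by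
    rw [forsMiss, lintegral_sub hm (ne_top_of_le_ne_top ENNReal.one_ne_top hhit) (ae_of_all _ hle),
      lintegral_one, measure_univ]
  ext s hs
  rw [forsLaw, Measure.sum_apply _ hs]
  simp only [Measure.smul_apply, smul_eq_mul]
  rw [ENNReal.tsum_mul_right, ENNReal.tsum_geometric, hmiss,
    ENNReal.sub_sub_cancel ENNReal.one_ne_top hhit]

lemma smul_withDensity_exp_eq_tilted {X : Type*} [MeasurableSpace X] {q : Measure X} [NeZero q]
    {g : X → ℝ} (hg : Integrable (fun x => Real.exp (g x)) q) :
    (∫⁻ x, ENNReal.ofReal (Real.exp (g x)) ∂q)⁻¹ •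
      q.withDensity (fun x => ENNReal.ofReal (Real.exp (g x))) = q.tilted g := by
  have hZ : 0 < ∫ x, Real.exp (g x) ∂q := integral_exp_pos hg
  rw [← ofReal_integral_eq_lintegral_ofReal hg (ae_of_all _ fun x => (Real.exp_pos _).le),
    ← withDensity_smul' _ _ (ENNReal.inv_ne_top.2 (ENNReal.ofReal_pos.2 hZ).ne'), Measure.tilted]
  congr 1
  ext1 x
  rw [Pi.smul_apply, smul_eq_mul, ENNReal.ofReal_div_of_pos hZ, mul_comm, ENNReal.div_eq_inv_mul,
    mul_comm]

lemma forsLaw_eq_tilted (hB : 0 < B) (q : Measure (Vec d)) [IsProbabilityMeasure q]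
    {W : Vec d → Measure ℝ} [∀ x, IsProbabilityMeasure (W x)]
    (hW : ∀ x, ∀ᵐ w ∂W x, w ∈ Set.Icc (-B) B) (hm : Measurable fun x => ∫ w, w ∂W x) :
    forsLaw B q W = q.tilted fun x => ∫ w, w ∂W x := by
  have hle (x : Vec d) : Real.exp (∫ w, w ∂W x - B) ≤ 1 :=
    Real.exp_le_one_iff.2 (sub_nonpos.2 (abs_le.1 (abs_integral_id_le_of_ae_mem_Icc (hW x))).2)
  have hint : Integrable (fun x => Real.exp (∫ w, w ∂W x - B)) q :=
    .of_bound (hm.sub_const B).exp.aestronglyMeasurable 1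
      (ae_of_all _ fun x => by simpa only [Real.norm_eq_abs, Real.abs_exp] using hle x)
  have hshift : q.tilted (fun x => ∫ w, w ∂W x) = q.tilted fun x => ∫ w, w ∂W x - B := by
    conv_lhs => rw [← tilted_const q (-B), tilted_tilted (integrable_const _)]
    simp only [Pi.add_def, neg_add_eq_sub]
  have haccept (x : Vec d) := forsAccept_eq hB (hW x)
  rw [forsLaw_eq_smul_forsHit q, forsHit, hshift, ← smul_withDensity_exp_eq_tilted hint]
  · simp only [haccept]
  · simpa only [haccept] using (hm.sub_const B).exp.ennreal_ofReal
  · simpa only [haccept, ENNReal.ofReal_le_one] using hle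

end Fors

/-! ### The straight-line estimators -/

section Line

variable {d : ℕ} {B : ℝ} {s : Vec d → Vec d}

lemma abs_clip_le (hB : 0 ≤ B) (a : ℝ) : |clip B a| ≤ B :=
  abs_le.2 ⟨le_max_left _ _, max_le (by linarith) (min_le_left _ _)⟩

@[fun_prop]
lemma measurable_clip (B : ℝ) : Measurable (clip B) := by
  unfold clip
  fun_prop

instance isProbabilityMeasure_restrict_Icc :
    IsProbabilityMeasure (volume.restrict (Set.Icc (0 : ℝ) 1)) :=
  ⟨by simp⟩

lemma measurable_clip_inner_line (hs : Measurable s) (y x : Vec d) :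
    Measurable fun r : ℝ => clip B (inner ℝ (x - y) (s (r • x + (1 - r) • y))) := by
  fun_prop

lemma isProbabilityMeasure_lineEstimator (hs : Measurable s) (y x : Vec d) :
    IsProbabilityMeasure (lineEstimator B s y x) :=
  Measure.isProbabilityMeasure_map (measurable_clip_inner_line hs y x).aemeasurable

lemma lineEstimator_ae_mem_Icc (hB : 0 ≤ B) (hs : Measurable s) (y x : Vec d) :
    ∀ᵐ w ∂lineEstimator B s y x, w ∈ Set.Icc (-B) B :=
  (ae_map_iff (measurable_clip_inner_line hs y x).aemeasurable measurableSet_Icc).2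
    (ae_of_all _ fun _ => abs_le.1 (abs_clip_le hB _))

/-- The mean of the clipped straight-line estimator, in the coordinates of `tiltedKernel`. -/
def lineMean (B : ℝ) (s : Vec d → Vec d) (y x : Vec d) : ℝ := ∫ w, w ∂lineEstimator B s y x

lemma lineMean_eq (hs : Measurable s) (y x : Vec d) :
    lineMean B s y x =
      ∫ r in Set.Icc (0 : ℝ) 1, clip B (inner ℝ (x - y) (s (r • x + (1 - r) • y))) :=
  integral_map (measurable_clip_inner_line hs y x).aemeasurable aestronglyMeasurable_id

lemma abs_lineMean_le (hB : 0 ≤ B) (hs : Measurable s) (y x : Vec d) : |lineMean B s y x| ≤ B :=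
  have := isProbabilityMeasure_lineEstimator (B := B) hs y x
  abs_integral_id_le_of_ae_mem_Icc (lineEstimator_ae_mem_Icc hB hs y x)

lemma measurable_lineMean (hs : Measurable s) : Measurable (Function.uncurry (lineMean B s)) := by
  have hmeas : Measurable fun q : (Vec d × Vec d) × ℝ =>
      clip B (inner ℝ (q.1.2 - q.1.1) (s (q.2 • q.1.2 + (1 - q.2) • q.1.1))) := by fun_prop
  have h : Function.uncurry (lineMean B s) = fun q => ∫ r in Set.Icc (0 : ℝ) 1,
      clip B (inner ℝ (q.2 - q.1) (s (r • q.2 + (1 - r) • q.1))) :=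
    funext fun q => lineMean_eq hs q.1 q.2
  rw [h]
  exact (hmeas.stronglyMeasurable.integral_prod_right'
    (ν := volume.restrict (Set.Icc (0 : ℝ) 1))).measurable

lemma forsLaw_lineEstimator (hB : 0 < B) (hs : Measurable s) (y : Vec d) (h : ℝ) :
    forsLaw B (isoGaussian y h) (lineEstimator B s y) =
      tiltedKernel (heatKernel h) (lineMean B s) y := by
  have := isProbabilityMeasure_lineEstimator (B := B) hs y
  rw [tiltedKernel_apply (measurable_lineMean hs)]
  exact forsLaw_eq_tilted hB _ (lineEstimator_ae_mem_Icc hB.le hs y)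
    (measurable_lineMean hs).of_uncurry_left

lemma bind_backwardStep {α η : ℕ → ℝ} {s : ℕ → Vec d → Vec d} {t : ℕ} (hB : 0 < B)
    (hs : Measurable (s t)) (ν : Measure (Vec d)) :
    ν.bind (backwardStep B α η s t) =
      (ν.map ((α t)⁻¹ • ·)).bind (tiltedKernel (heatKernel (η t)) (lineMean B (s t))) := by
  have hstep : backwardStep B α η s t =
      tiltedKernel (heatKernel (η t)) (lineMean B (s t)) ∘ ((α t)⁻¹ • ·) :=
    funext fun x => forsLaw_lineEstimator hB hs _ _
  rw [hstep, Measure.bind, Measure.bind, Measure.map_map (Kernel.measurable _) (by fun_prop)]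

end Line

/-! ### The error of one backward step -/

section ClippedDefect

variable {B : ℝ}

lemma abs_sub_clip_le_abs_sub {a : ℝ} (ha : |a| ≤ B) (b : ℝ) : |a - clip B b| ≤ |a - b| := by
  have hclip : clip B a = a := by
    rw [clip, min_eq_right (abs_le.1 ha).2, max_eq_right (abs_le.1 ha).1]
  calc |a - clip B b| = |clip B a - clip B b| := by rw [hclip]
    _ ≤ |min B a - min B b| := by
      simpa only [clip, max_comm (-B)] using abs_max_sub_max_le_abs (min B a) (min B b) (-B)
    _ ≤ |a - b| := by simpa using abs_min_sub_min_le_max B a B b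

lemma expDefect_sub_clip_le_of_abs_le (hB : 0 ≤ B) {a : ℝ} (ha : |a| ≤ B) (b : ℝ) :
    expDefect (a - clip B b) ≤ (a - b) ^ 2 * Real.exp (2 * B) := by
  have habs : |a - clip B b| ≤ 2 * B := by
    linarith [abs_sub a (clip B b), abs_clip_le hB b]
  calc expDefect (a - clip B b) ≤ (a - clip B b) ^ 2 * Real.exp |a - clip B b| :=
        expDefect_le_sq_mul_exp_abs _
    _ ≤ (a - b) ^ 2 * Real.exp (2 * B) := mul_le_mul
        (sq_le_sq.2 (abs_sub_clip_le_abs_sub ha b)) (Real.exp_le_exp.2 habs)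
        (Real.exp_pos _).le (sq_nonneg _)

lemma expDefect_sub_clip_le_exp (hB : 0 ≤ B) (a b : ℝ) :
    expDefect (a - clip B b) ≤ Real.exp (|a| + B) :=
  (expDefect_le_exp_abs _).trans
    (Real.exp_le_exp.2 ((abs_sub _ _).trans (add_le_add_right (abs_clip_le hB b) _)))

lemma exp_mul_max_abs_le {m : ℝ} (hm : 0 ≤ m) (c a : ℝ) :
    Real.exp (m * max c |a|) ≤ Real.exp (m * c) + Real.exp (m * a) + Real.exp (-(m * a)) := by
  rcases max_choice c |a| with h | h <;> rw [h]
  · linarith [Real.exp_pos (m * a), Real.exp_pos (-(m * a))]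
  · rw [← abs_of_nonneg hm, ← abs_mul, abs_of_nonneg hm]
    linarith [Real.exp_abs_le (m * a), Real.exp_pos (m * c)]

/-- If `c` or `|a|` exceeds `B`, the left-hand side is at most `exp (B + 2 * max c |a|)`, which is
absorbed by the exponential moments of order `m ≥ 2`. -/
lemma exp_mul_expDefect_sub_clip_le (hB : 0 ≤ B) {m : ℝ} (hm : 2 ≤ m) (c a b : ℝ) :
    Real.exp c * expDefect (a - clip B b) ≤
      Real.exp (3 * B) * ((a - b) ^ 2 +
        Real.exp (-(m * B)) * (Real.exp (m * c) + Real.exp (m * a) + Real.exp (-(m * a)))) := by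
  rcases le_or_gt (max c |a|) B with hle | hgt
  · obtain ⟨hc, ha⟩ := max_le_iff.1 hle
    calc Real.exp c * expDefect (a - clip B b)
        ≤ Real.exp B * ((a - b) ^ 2 * Real.exp (2 * B)) :=
          mul_le_mul (Real.exp_le_exp.2 hc) (expDefect_sub_clip_le_of_abs_le hB ha b)
            (expDefect_nonneg _) (Real.exp_pos _).le
      _ = Real.exp (3 * B) * (a - b) ^ 2 := by
          rw [mul_left_comm, ← Real.exp_add, mul_comm]
          ring_nf
      _ ≤ _ := mul_le_mul_of_nonneg_left (le_add_of_nonneg_right (by positivity))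
          (Real.exp_pos _).le
  · have hexponent : c + (|a| + B) ≤ 3 * B + (-(m * B) + m * max c |a|) := by
      nlinarith [le_max_left c |a|, le_max_right c |a|,
        mul_nonneg (sub_nonneg.2 hm) (sub_nonneg.2 hgt.le)]
    calc Real.exp c * expDefect (a - clip B b)
        ≤ Real.exp c * Real.exp (|a| + B) :=
          mul_le_mul_of_nonneg_left (expDefect_sub_clip_le_exp hB a b) (Real.exp_pos _).le
      _ ≤ Real.exp (3 * B) * (Real.exp (-(m * B)) * Real.exp (m * max c |a|)) := by
          simpa only [← Real.exp_add] using Real.exp_le_exp.2 hexponent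
      _ ≤ _ := by
          refine mul_le_mul_of_nonneg_left ?_ (Real.exp_pos _).le
          exact (mul_le_mul_of_nonneg_left (exp_mul_max_abs_le (by linarith) c a)
            (Real.exp_pos _).le).trans (le_add_of_nonneg_left (sq_nonneg _))

end ClippedDefect

section OneStep

variable {d : ℕ} {B v m : ℝ} (P : Measure (Vec d)) [IsFiniteMeasure P] [NeZero P]
  {s : Vec d → Vec d}

lemma gaussMix_mul_exp_le (hv : 0 < v) {z w : Vec d} {x c : ℝ}
    (h : x ≤ Real.log (gaussMix P v w) - Real.log (gaussMix P v z) + c) :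
    gaussMix P v z * Real.exp x ≤ Real.exp c * gaussMix P v w := by
  have hp := gaussMix_pos P hv
  calc gaussMix P v z * Real.exp x
      = Real.exp (Real.log (gaussMix P v z) + x) := by rw [Real.exp_add, Real.exp_log (hp z)]
    _ ≤ Real.exp (c + Real.log (gaussMix P v w)) := Real.exp_le_exp.2 (by linarith)
    _ = Real.exp c * gaussMix P v w := by rw [Real.exp_add, Real.exp_log (hp w)]

lemma gaussMix_mul_exp_log_ratio_le (hv : 0 < v) (hm : 1 ≤ m) (z u : Vec d) {τ : ℝ}
    (hτ : τ ∈ Set.Icc (0 : ℝ) 1) :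
    gaussMix P v z *
        Real.exp (m * (Real.log (gaussMix P v (z + τ • u)) - Real.log (gaussMix P v z))) ≤
      Real.exp (m ^ 2 / (2 * v) * ‖u‖ ^ 2) * gaussMix P v (z + (m * τ) • u) := by
  refine gaussMix_mul_exp_le P hv ?_
  have hratio := mul_log_gaussMix_sub_le P hv z (τ • u) hm
  rw [smul_smul, norm_smul, Real.norm_of_nonneg hτ.1] at hratio
  have herror : m * (m - 1) * ((τ * ‖u‖) ^ 2 / (2 * v)) ≤ m ^ 2 * (‖u‖ ^ 2 / (2 * v)) := by
    have hτu : τ * ‖u‖ ≤ ‖u‖ := mul_le_of_le_one_left (norm_nonneg u) hτ.2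
    have hτ0 := hτ.1
    gcongr
    nlinarith
  rw [div_mul_eq_mul_div, mul_div_assoc]
  linarith

lemma gaussMix_mul_exp_inner_score_le (hv : 0 < v) (z u : Vec d) (m : ℝ) :
    gaussMix P v z * Real.exp (m * inner ℝ u (gaussMixScore P v z)) ≤
      Real.exp (m ^ 2 / (2 * v) * ‖u‖ ^ 2) * gaussMix P v (z + m • u) := by
  refine gaussMix_mul_exp_le P hv ?_
  have htangent := log_gaussMix_add_inner_score_le P hv z (m • u)
  rw [real_inner_smul_left, norm_smul, mul_pow, Real.norm_eq_abs, sq_abs, mul_div_right_comm]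
    at htangent
  linarith

/-- The defect at the point `z = y + r • (x - y)` of the segment from `y` to `x = z + τ • u`. -/
lemma gaussMix_mul_expDefect_le (hB : 0 ≤ B) (hv : 0 < v) (hm : 2 ≤ m) (z u : Vec d) {τ : ℝ}
    (hτ : τ ∈ Set.Icc (0 : ℝ) 1) :
    gaussMix P v (z + τ • u) *
        expDefect (inner ℝ u (gaussMixScore P v z) - clip B (inner ℝ u (s z))) ≤
      Real.exp (3 * B) * (gaussMix P v z * inner ℝ u (gaussMixScore P v z - s z) ^ 2 +
        Real.exp (-(m * B)) * Real.exp (m ^ 2 / (2 * v) * ‖u‖ ^ 2) *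
          (gaussMix P v (z + (m * τ) • u) + gaussMix P v (z + m • u) +
            gaussMix P v (z + (-m) • u))) := by
  set p := gaussMix P v
  set a : ℝ := inner ℝ u (gaussMixScore P v z)
  set b : ℝ := inner ℝ u (s z)
  set c := Real.log (p (z + τ • u)) - Real.log (p z)
  set E := Real.exp (m ^ 2 / (2 * v) * ‖u‖ ^ 2)
  have hp : ∀ x, 0 < p x := gaussMix_pos P hv
  have hratio : p (z + τ • u) = p z * Real.exp c := by
    rw [Real.exp_sub, Real.exp_log (hp _), Real.exp_log (hp _), mul_div_cancel₀ _ (hp z).ne']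
  have hmoments : p z * (Real.exp (m * c) + Real.exp (m * a) + Real.exp (-(m * a))) ≤
      E * (p (z + (m * τ) • u) + p (z + m • u) + p (z + (-m) • u)) := by
    have hτu := gaussMix_mul_exp_log_ratio_le P hv (by linarith) z u hτ (m := m)
    have hpos := gaussMix_mul_exp_inner_score_le P hv z u m
    have hneg := gaussMix_mul_exp_inner_score_le P hv z u (-m)
    rw [neg_sq, neg_mul] at hneg
    linarith
  calc p (z + τ • u) * expDefect (a - clip B b)
      = p z * (Real.exp c * expDefect (a - clip B b)) := by rw [hratio, mul_assoc]
    _ ≤ p z * (Real.exp (3 * B) * ((a - b) ^ 2 + Real.exp (-(m * B)) *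
          (Real.exp (m * c) + Real.exp (m * a) + Real.exp (-(m * a))))) :=
        mul_le_mul_of_nonneg_left (exp_mul_expDefect_sub_clip_le hB hm c a b) (hp z).le
    _ = Real.exp (3 * B) * (p z * (a - b) ^ 2 + Real.exp (-(m * B)) *
          (p z * (Real.exp (m * c) + Real.exp (m * a) + Real.exp (-(m * a))))) := by ring
    _ ≤ Real.exp (3 * B) * (p z * (a - b) ^ 2 + Real.exp (-(m * B)) *
          (E * (p (z + (m * τ) • u) + p (z + m • u) + p (z + (-m) • u)))) := by gcongr
    _ = _ := by rw [inner_sub_right, mul_assoc (Real.exp (-(m * B)))]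

/-- Jensen's inequality along the segment from `y` to `y + u`. -/
lemma expDefect_log_gaussMix_sub_lineMean_le (hB : 0 ≤ B) (hv : 0 < v) (hs : Measurable s)
    (y u : Vec d) :
    ENNReal.ofReal (expDefect (Real.log (gaussMix P v (y + u)) - Real.log (gaussMix P v y) -
        lineMean B s y (y + u))) ≤
      ∫⁻ r in Set.Icc (0 : ℝ) 1, ENNReal.ofReal (expDefect
        (inner ℝ u (gaussMixScore P v (y + r • u)) - clip B (inner ℝ u (s (y + r • u))))) := by
  have hscore := continuous_gaussMixScore P hv
  set I := volume.restrict (Set.Icc (0 : ℝ) 1)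
  set F : ℝ → ℝ := fun r => inner ℝ u (gaussMixScore P v (y + r • u))
  set G : ℝ → ℝ := fun r => clip B (inner ℝ u (s (y + r • u)))
  have hFc : Continuous F := by fun_prop
  have hFi : Integrable F I := hFc.continuousOn.integrableOn_compact isCompact_Icc
  have hGi : Integrable G I :=
    .of_bound (by fun_prop) B (ae_of_all _ fun r => abs_clip_le hB _)
  have hmean : lineMean B s y (y + u) = ∫ r, G r ∂I := by
    rw [lineMean_eq hs]
    refine integral_congr_ae (ae_of_all _ fun r => ?_)
    simp only [G, add_sub_cancel_left]
    rw [show r • (y + u) + (1 - r) • y = y + r • u by module]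
  obtain ⟨M, hM⟩ := isCompact_Icc.exists_bound_of_continuousOn (s := Set.Icc (0 : ℝ) 1)
    hFc.continuousOn
  have hint : Integrable (fun r => expDefect (F r - G r)) I := by
    refine .of_bound (by fun_prop) (Real.exp (M + B)) ?_
    refine (ae_restrict_mem measurableSet_Icc).mono fun r hr => ?_
    rw [Real.norm_of_nonneg (expDefect_nonneg _)]
    exact (expDefect_sub_clip_le_exp hB _ _).trans (Real.exp_le_exp.2 (by gcongr; exact hM r hr))
  rw [log_gaussMix_sub_eq_integral P hv, hmean, ← integral_sub hFi hGi,
    ← ofReal_integral_eq_lintegral_ofReal hint (ae_of_all _ fun _ => expDefect_nonneg _)]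
  exact ENNReal.ofReal_le_ofReal (convexOn_expDefect.map_integral_le
    continuous_expDefect.continuousOn isClosed_univ (ae_of_all _ fun _ => Set.mem_univ _)
    (hFi.sub hGi) hint)

end OneStep

section IntegratedError

variable {d : ℕ} {B v m h δ : ℝ} (P : Measure (Vec d)) [IsProbabilityMeasure P]
  {s : Vec d → Vec d}

lemma lintegral_conv_isoGaussian (hv : 0 < v) {f : Vec d → ℝ≥0∞} (hf : Measurable f) :
    ∫⁻ z, f z ∂(P ∗ isoGaussian 0 v) = ∫⁻ z, ENNReal.ofReal (gaussMix P v z) * f z := by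
  rw [conv_isoGaussian_eq_withDensity P hv]
  exact lintegral_withDensity_eq_lintegral_mul _
    (continuous_gaussMix P hv).measurable.ennreal_ofReal hf

lemma lintegral_gaussMix_add (hv : 0 < v) (w : Vec d) :
    ∫⁻ z, ENNReal.ofReal (gaussMix P v (z + w)) = 1 := by
  rw [lintegral_add_right_eq_self (fun z => ENNReal.ofReal (gaussMix P v z)) w]
  simpa using (lintegral_conv_isoGaussian P hv measurable_one).symm

lemma lintegral_shifted_expDefect_le (hB : 0 ≤ B) (hv : 0 < v) (hs : Measurable s) (hm : 2 ≤ m)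
    (u : Vec d) {τ : ℝ} (hτ : τ ∈ Set.Icc (0 : ℝ) 1) :
    ∫⁻ z, ENNReal.ofReal (gaussMix P v (z + τ • u) *
        expDefect (inner ℝ u (gaussMixScore P v z) - clip B (inner ℝ u (s z)))) ≤
      ENNReal.ofReal (Real.exp (3 * B)) *
        (∫⁻ z, ENNReal.ofReal (inner ℝ u (gaussMixScore P v z - s z) ^ 2) ∂(P ∗ isoGaussian 0 v) +
          ENNReal.ofReal (Real.exp (-(m * B)) * Real.exp (m ^ 2 / (2 * v) * ‖u‖ ^ 2)) * 3) := by
  have hp := gaussMix_pos P hv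
  have hdensity := (continuous_gaussMix P hv).measurable
  have hscore := (continuous_gaussMixScore P hv).measurable
  set E := Real.exp (-(m * B)) * Real.exp (m ^ 2 / (2 * v) * ‖u‖ ^ 2)
  set p := gaussMix P v
  have hp0 (z : Vec d) : 0 ≤ p z := (hp z).le
  have hE : 0 ≤ E := by positivity
  calc _ ≤ ∫⁻ z, ENNReal.ofReal (Real.exp (3 * B)) *
        (ENNReal.ofReal (p z) * ENNReal.ofReal (inner ℝ u (gaussMixScore P v z - s z) ^ 2) +
          ENNReal.ofReal E * (ENNReal.ofReal (p (z + (m * τ) • u)) +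
            ENNReal.ofReal (p (z + m • u)) + ENNReal.ofReal (p (z + (-m) • u)))) := by
        refine lintegral_mono fun z => ?_
        rw [← ENNReal.ofReal_mul (hp0 z), ← ENNReal.ofReal_add (hp0 _) (hp0 _),
          ← ENNReal.ofReal_add (add_nonneg (hp0 _) (hp0 _)) (hp0 _), ← ENNReal.ofReal_mul hE,
          ← ENNReal.ofReal_add (mul_nonneg (hp0 z) (sq_nonneg _))
            (mul_nonneg hE (add_nonneg (add_nonneg (hp0 _) (hp0 _)) (hp0 _))),
          ← ENNReal.ofReal_mul (Real.exp_pos _).le]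
        exact ENNReal.ofReal_le_ofReal (gaussMix_mul_expDefect_le P hB hv hm z u hτ)
    _ = _ := by
        rw [lintegral_const_mul' _ _ ENNReal.ofReal_ne_top, lintegral_add_left (by fun_prop),
          lintegral_const_mul' _ _ ENNReal.ofReal_ne_top, lintegral_add_right _ (by fun_prop),
          lintegral_add_right _ (by fun_prop), lintegral_gaussMix_add P hv,
          lintegral_gaussMix_add P hv, lintegral_gaussMix_add P hv,
          lintegral_conv_isoGaussian P hv (by fun_prop)]
        norm_num [p]

lemma lintegral_expDefect_add_le (hB : 0 ≤ B) (hv : 0 < v) (hs : Measurable s) (hm : 2 ≤ m)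
    (u : Vec d) :
    ∫⁻ y, ENNReal.ofReal (gaussMix P v (y + u) * expDefect (Real.log (gaussMix P v (y + u)) -
        Real.log (gaussMix P v y) - lineMean B s y (y + u))) ≤
      ENNReal.ofReal (Real.exp (3 * B)) *
        (∫⁻ z, ENNReal.ofReal (inner ℝ u (gaussMixScore P v z - s z) ^ 2) ∂(P ∗ isoGaussian 0 v) +
          ENNReal.ofReal (Real.exp (-(m * B)) * Real.exp (m ^ 2 / (2 * v) * ‖u‖ ^ 2)) * 3) := by
  have hp := gaussMix_pos P hv
  have hdensity := (continuous_gaussMix P hv).measurable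
  have hscore := (continuous_gaussMixScore P hv).measurable
  set I := volume.restrict (Set.Icc (0 : ℝ) 1)
  set φ : Vec d → ℝ := fun z =>
    expDefect (inner ℝ u (gaussMixScore P v z) - clip B (inner ℝ u (s z)))
  have hφ : Measurable φ := by fun_prop
  calc _ ≤ ∫⁻ y, ∫⁻ r, ENNReal.ofReal (gaussMix P v (y + u) * φ (y + r • u)) ∂I := by
        refine lintegral_mono fun y => ?_
        simp only [ENNReal.ofReal_mul (hp _).le]
        rw [lintegral_const_mul' _ _ ENNReal.ofReal_ne_top]
        exact mul_le_mul_right (expDefect_log_gaussMix_sub_lineMean_le P hB hv hs y u) _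
    _ = ∫⁻ r, ∫⁻ y, ENNReal.ofReal (gaussMix P v (y + u) * φ (y + r • u)) ∂volume ∂I :=
        lintegral_lintegral_swap (by fun_prop)
    _ = ∫⁻ r, ∫⁻ z, ENNReal.ofReal (gaussMix P v (z + (1 - r) • u) * φ z) ∂volume ∂I := by
        refine lintegral_congr fun r => ?_
        rw [← lintegral_add_right_eq_self (fun z =>
          ENNReal.ofReal (gaussMix P v (z + (1 - r) • u) * φ z)) (r • u)]
        refine lintegral_congr fun y => ?_
        rw [show y + r • u + (1 - r) • u = y + u by module]
    _ ≤ _ := by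
        refine (lintegral_mono_ae ((ae_restrict_mem measurableSet_Icc).mono fun r hr =>
          lintegral_shifted_expDefect_le P hB hv hs hm u
            (Set.Icc.mem_iff_one_sub_mem.1 hr))).trans_eq ?_
        rw [lintegral_const, measure_univ, mul_one]

lemma lintegral_lintegral_inner_sq_isoGaussian (hh : 0 ≤ h) (μ : Measure (Vec d)) [SFinite μ]
    {g : Vec d → Vec d} (hg : Measurable g) :
    ∫⁻ u, ∫⁻ z, ENNReal.ofReal (inner ℝ u (g z) ^ 2) ∂μ ∂(isoGaussian 0 h) =
      ENNReal.ofReal h * ∫⁻ z, ENNReal.ofReal (‖g z‖ ^ 2) ∂μ := by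
  rw [lintegral_lintegral_swap (by fun_prop), ← lintegral_const_mul' _ _ ENNReal.ofReal_ne_top]
  refine lintegral_congr fun z => ?_
  simp only [real_inner_comm (g z)]
  rw [lintegral_inner_sq_isoGaussian hh, ENNReal.ofReal_mul hh]

lemma lintegral_exp_mul_exp_sq_norm_le (hv : 0 < v) (hh : 0 < h) (hmv : m ^ 2 * h / v ≤ 1 / 2)
    (hδ : Real.exp (-(m * B)) * Real.exp (m ^ 2 * h / v * d) ≤ δ) :
    ∫⁻ u : Vec d, ENNReal.ofReal (Real.exp (-(m * B)) * Real.exp (m ^ 2 / (2 * v) * ‖u‖ ^ 2))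
      ∂(isoGaussian 0 h) ≤ ENNReal.ofReal δ := by
  have hrate : 2 * (m ^ 2 / (2 * v)) * h = m ^ 2 * h / v := by field_simp
  simp only [ENNReal.ofReal_mul (Real.exp_pos _).le]
  rw [lintegral_const_mul' _ _ ENNReal.ofReal_ne_top]
  calc _ ≤ ENNReal.ofReal (Real.exp (-(m * B))) *
        ENNReal.ofReal (Real.exp (m ^ 2 * h / v * d)) := by
        gcongr
        rw [← hrate]
        exact lintegral_exp_mul_sq_norm_isoGaussian_le hh (by positivity) (hrate.trans_le hmv)
    _ ≤ ENNReal.ofReal δ := by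
        rw [← ENNReal.ofReal_mul (Real.exp_pos _).le]
        exact ENNReal.ofReal_le_ofReal hδ

lemma lintegral_expDefect_heatKernel_le (hB : 0 ≤ B) (hv : 0 < v) (hh : 0 < h)
    (hs : Measurable s) (hm : 2 ≤ m) (hmv : m ^ 2 * h / v ≤ 1 / 2)
    (hδ : Real.exp (-(m * B)) * Real.exp (m ^ 2 * h / v * d) ≤ δ) :
    ∫⁻ y, ∫⁻ x, ENNReal.ofReal (gaussMix P v x * expDefect (Real.log (gaussMix P v x) -
        Real.log (gaussMix P v y) - lineMean B s y x)) ∂heatKernel h y ≤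
      ENNReal.ofReal (Real.exp (3 * B)) * (ENNReal.ofReal h *
        ∫⁻ z, ENNReal.ofReal (‖s z - gaussMixScore P v z‖ ^ 2) ∂(P ∗ isoGaussian 0 v) +
          ENNReal.ofReal δ * 3) := by
  have hdensity := (continuous_gaussMix P hv).measurable
  have hscore := (continuous_gaussMixScore P hv).measurable
  have hmean := measurable_lineMean (B := B) hs
  set f : Vec d → Vec d → ℝ≥0∞ := fun y x => ENNReal.ofReal (gaussMix P v x *
    expDefect (Real.log (gaussMix P v x) - Real.log (gaussMix P v y) - lineMean B s y x))
  have hf : Measurable (Function.uncurry f) := by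
    simp only [f, Function.uncurry_def] at hmean ⊢
    fun_prop
  calc ∫⁻ y, ∫⁻ x, f y x ∂heatKernel h y
      = ∫⁻ y, ∫⁻ u, f y (y + u) ∂isoGaussian 0 h :=
        lintegral_congr fun y => lintegral_isoGaussian y h hf.of_uncurry_left
    _ = ∫⁻ u, ∫⁻ y, f y (y + u) ∂volume ∂isoGaussian 0 h :=
        lintegral_lintegral_swap (hf.comp (by fun_prop :
          Measurable fun q : Vec d × Vec d => (q.1, q.1 + q.2))).aemeasurable
    _ ≤ _ := lintegral_mono fun u => lintegral_expDefect_add_le P hB hv hs hm u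
    _ ≤ _ := by
        rw [lintegral_const_mul' _ _ ENNReal.ofReal_ne_top, lintegral_add_right _ (by fun_prop),
          lintegral_lintegral_inner_sq_isoGaussian hh.le _ (by fun_prop),
          lintegral_mul_const' _ _ (by norm_num)]
        simp only [norm_sub_rev (gaussMixScore P v _)]
        gcongr
        exact lintegral_exp_mul_exp_sq_norm_le hv hh hmv hδ

end IntegratedError

/-! ### The backward sampler -/

section Sampler

variable {d : ℕ} {B : ℝ} {α η : ℕ → ℝ} {s : ℕ → Vec d → Vec d}

lemma isFiniteMeasure_forwardLaw (pdata : Measure (Vec d)) [IsFiniteMeasure pdata] {t : ℕ}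
    (hη : ∀ j < t, 0 ≤ η j) : IsFiniteMeasure (forwardLaw α η pdata t) := by
  rw [forwardLaw_eq_conv pdata hη]
  infer_instance

lemma map_inv_smul_forwardLaw_succ (pdata : Measure (Vec d)) {t : ℕ} (hα : α t ≠ 0)
    (hη : 0 ≤ η t) :
    (forwardLaw α η pdata (t + 1)).map ((α t)⁻¹ • ·) =
      (forwardLaw α η pdata t).bind (heatKernel (η t)) := by
  rw [forwardLaw, bind_isoGaussian_smul _ _ hη, bind_heatKernel,
    Measure.map_map (by fun_prop) (by fun_prop)]
  simp only [Function.comp_def, inv_smul_smul₀ hα, Measure.map_id']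

lemma klDiv_bind_backwardStep_le {δ m : ℝ} {t : ℕ} (hB : 0 < B) (pdata : Measure (Vec d))
    [IsProbabilityMeasure pdata] (hs : Measurable (s t)) (hα : α t ≠ 0) (hη : ∀ j ≤ t, 0 < η j)
    (hv : 0 < noiseVar α η t) (hm : 2 ≤ m) (hmv : m ^ 2 * η t / noiseVar α η t ≤ 1 / 2)
    (hδ : Real.exp (-(m * B)) * Real.exp (m ^ 2 * η t / noiseVar α η t * d) ≤ δ)
    (ν : Measure (Vec d)) [IsFiniteMeasure ν] :
    klDiv (forwardLaw α η pdata t) (ν.bind (backwardStep B α η s t)) ≤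
      klDiv (forwardLaw α η pdata (t + 1)) ν + ENNReal.ofReal (Real.exp (3 * B)) *
        (ENNReal.ofReal (η t) * scoreErrorSq α η pdata s t + ENNReal.ofReal δ * 3) := by
  set P := pdata.map (scale α t • ·)
  have : IsProbabilityMeasure P := Measure.isProbabilityMeasure_map (by fun_prop)
  have hη0 : ∀ j ≤ t, 0 ≤ η j := fun j hj => (hη j hj).le
  have hconv := forwardLaw_eq_conv (α := α) pdata fun j hj => hη0 j hj.le
  have hlaw := forwardLaw_eq_withDensity pdata (fun j hj => hη0 j hj.le) hv
  have := isFiniteMeasure_forwardLaw (α := α) (t := t + 1) pdata fun j hj =>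
    hη0 j (Nat.lt_succ_iff.1 hj)
  have hfinite := isFiniteMeasure_forwardLaw (α := α) pdata fun j hj => hη0 j hj.le
  rw [hlaw] at hfinite
  have hstep := klDiv_bind_tiltedKernel_le (map_swap_volume_compProd_heatKernel (hη0 t le_rfl))
    (continuous_gaussMix P hv).measurable (gaussMix_pos P hv) (measurable_lineMean hs)
    (fun y x => (abs_le.1 (abs_lineMean_le hB.le hs y x)).2) (ν.map ((α t)⁻¹ • ·))
  have herror := lintegral_expDefect_heatKernel_le P hB.le hv (hη t le_rfl) hs hm hmv hδ
  rw [← hlaw, ← map_inv_smul_forwardLaw_succ pdata hα (hη0 t le_rfl),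
    ← bind_backwardStep hB hs] at hstep
  rw [scoreErrorSq, score_eq_gaussMixScore, hconv]
  rw [hconv] at hstep
  exact hstep.trans (add_le_add (klDiv_map_le _ _ (by fun_prop)) herror)

lemma isProbabilityMeasure_backwardLaw (hB : 0 < B) (hs : ∀ t, Measurable (s t))
    (μ : Measure (Vec d)) [IsProbabilityMeasure μ] (t k : ℕ) :
    IsProbabilityMeasure (backwardLaw B α η s μ t k) := by
  induction k generalizing t with
  | zero => assumption
  | succ k ih =>
    have := ih (t + 1)
    have := isMarkovKernel_tiltedKernel (κ := heatKernel (η t)) (measurable_lineMean (hs t))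
      fun y x => (abs_le.1 (abs_lineMean_le hB.le (hs t) y x)).2
    have := Measure.isProbabilityMeasure_map (μ := backwardLaw B α η s μ (t + 1) k)
      (f := ((α t)⁻¹ • ·)) (by fun_prop)
    rw [backwardLaw, bind_backwardStep hB (hs t)]
    infer_instance

lemma klDiv_backwardLaw_le (hB : 0 < B) (hs : ∀ t, Measurable (s t)) (pdata μ : Measure (Vec d))
    [IsProbabilityMeasure μ] {error : ℕ → ℝ≥0∞} (t k : ℕ)
    (hstep : ∀ j ∈ Set.Ico t (t + k), ∀ ν : Measure (Vec d), IsProbabilityMeasure ν →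
      klDiv (forwardLaw α η pdata j) (ν.bind (backwardStep B α η s j)) ≤
        klDiv (forwardLaw α η pdata (j + 1)) ν + error j) :
    klDiv (forwardLaw α η pdata t) (backwardLaw B α η s μ t k) ≤
      klDiv (forwardLaw α η pdata (t + k)) μ + ∑ j ∈ Finset.Ico t (t + k), error j := by
  induction k generalizing t with
  | zero => simp [backwardLaw]
  | succ k ih =>
    rw [← add_assoc, add_right_comm] at hstep ⊢
    calc klDiv (forwardLaw α η pdata t) (backwardLaw B α η s μ t (k + 1))
        ≤ klDiv (forwardLaw α η pdata (t + 1)) (backwardLaw B α η s μ (t + 1) k) + error t :=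
          hstep t ⟨le_rfl, by omega⟩ _ (isProbabilityMeasure_backwardLaw hB hs μ (t + 1) k)
      _ ≤ klDiv (forwardLaw α η pdata (t + 1 + k)) μ +
          ∑ j ∈ Finset.Ico (t + 1) (t + 1 + k), error j + error t := by
          gcongr
          exact ih (t + 1) fun j hj => hstep j ⟨(Nat.le_succ t).trans hj.1, hj.2⟩
      _ = _ := by
          rw [Finset.sum_eq_sum_Ico_succ_bot (by omega : t < t + 1 + k), add_assoc,
            add_comm (error t)]

end Sampler

/-! ### The choice of the constants -/

lemma exists_moment_order {b : ℝ} (hb : 0 < b) :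
    ∃ K > (0 : ℝ), ∀ (B δ h v : ℝ) (d : ℕ), b ≤ B → 0 < δ → δ ≤ 1 / 2 → 0 < h → 0 < v →
      K * (d * Real.log (1 / δ) + Real.log (1 / δ) ^ 2) ≤ v / h →
      ∃ m : ℝ, 2 ≤ m ∧ m ^ 2 * h / v ≤ 1 / 2 ∧
        Real.exp (-(m * B)) * Real.exp (m ^ 2 * h / v * d) ≤ δ := by
  have hlog2 : 0 < Real.log 2 := Real.log_pos one_lt_two
  set A : ℝ := 2 / b + 2 / Real.log 2
  have : 0 < A := by positivity
  refine ⟨2 * A ^ 2, by positivity, fun B δ h v d hbB hδ hδ2 hh hv hK => ?_⟩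
  set L := Real.log (1 / δ) with hL
  have hL2 : Real.log 2 ≤ L := Real.log_le_log two_pos (by rw [le_div_iff₀ hδ]; linarith)
  have hL0 : 0 < L := hlog2.trans_le hL2
  have hδL : δ = Real.exp (-L) := by rw [hL, one_div, Real.log_inv, neg_neg, Real.exp_log hδ]
  rw [le_div_iff₀ hh] at hK
  have hm : 2 ≤ A * L := calc
    2 ≤ 2 / Real.log 2 * L := by rw [div_mul_eq_mul_div, le_div_iff₀ hlog2]; linarith
    _ ≤ A * L := by gcongr; exact le_add_of_nonneg_left (by positivity)
  have hmB : 2 * L ≤ A * L * B := calc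
    2 * L = 2 / b * L * b := by field_simp
    _ ≤ A * L * B := by gcongr; exact le_add_of_nonneg_right (by positivity)
  have hmv : (A * L) ^ 2 * h / v ≤ 1 / 2 := by
    rw [div_le_iff₀ hv]
    have : 0 ≤ A ^ 2 * (d * L) * h := by positivity
    linarith
  have hmvd : (A * L) ^ 2 * h / v * d ≤ L := by
    rw [div_mul_eq_mul_div, div_le_iff₀ hv]
    have : 0 ≤ A ^ 2 * L ^ 2 * h := by positivity
    have : 0 ≤ A ^ 2 * L ^ 2 * h * d := by positivity
    nlinarith
  refine ⟨A * L, hm, hmv, ?_⟩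
  rw [← Real.exp_add, hδL]
  exact Real.exp_le_exp.2 (by linarith)

lemma add_sum_le_three_mul {c D : ℝ≥0∞} (hc : 1 ≤ c) (ε : ℕ → ℝ≥0∞) (T : ℕ) (δ : ℝ) :
    D + ∑ t ∈ Finset.Ico 1 T, c * (ε t + ENNReal.ofReal δ * 3) ≤
      3 * c * (D + ENNReal.ofReal (T * δ) + ∑ t ∈ Finset.Ico 1 T, ε t) := by
  have h3 : (1 : ℝ≥0∞) ≤ 3 := by norm_num
  have hcard : (T - 1) • (ENNReal.ofReal δ * 3) ≤ 3 * ENNReal.ofReal (T * δ) := by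
    rw [nsmul_eq_mul, ENNReal.ofReal_mul (Nat.cast_nonneg _), ENNReal.ofReal_natCast,
      mul_comm _ (3 : ℝ≥0∞), mul_left_comm]
    gcongr
    exact Nat.sub_le T 1
  rw [← Finset.mul_sum, Finset.sum_add_distrib, Finset.sum_const, Nat.card_Ico]
  calc D + c * (∑ t ∈ Finset.Ico 1 T, ε t + (T - 1) • (ENNReal.ofReal δ * 3))
      ≤ 3 * c * D + c * (3 * ∑ t ∈ Finset.Ico 1 T, ε t + 3 * ENNReal.ofReal (T * δ)) := by
        gcongr
        · exact le_mul_of_one_le_left' (one_le_mul h3 hc)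
        · exact le_mul_of_one_le_left' h3
    _ = _ := by ring

end Diffusion

end

theorem theorem3 (b₁ b₂ : ℝ) (hb₁ : 0 < b₁) (hb : b₁ ≤ b₂) :
    ∃ K > (0 : ℝ), ∃ C : ℝ≥0, ∀ B ∈ Set.Icc b₁ b₂,
      ∀ (d T : ℕ) (α η : ℕ → ℝ) (δ : ℝ)
        (pdata : Measure (Diffusion.Vec d)) (pinit : Measure (Diffusion.Vec d))
        (s : ℕ → Diffusion.Vec d → Diffusion.Vec d),
        1 ≤ T →
        IsProbabilityMeasure pdata →
        IsProbabilityMeasure pinit →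
        (∀ t, Measurable (s t)) →
        (∀ t < T, α t ≠ 0) →
        (∀ t < T, 0 < η t) →
        0 < δ → δ ≤ 1 / 2 →
        (∀ t, 1 ≤ t → t < T →
          K * (d * Real.log (1 / δ) + Real.log (1 / δ) ^ 2) ≤
            Diffusion.noiseVar α η t / η t) →
        IsProbabilityMeasure (Diffusion.backwardLaw B α η s pinit 1 (T - 1)) ∧
        klDiv (Diffusion.forwardLaw α η pdata 1) (Diffusion.backwardLaw B α η s pinit 1 (T - 1)) ≤
          C * (klDiv (Diffusion.forwardLaw α η pdata T) pinit + ENNReal.ofReal (T * δ) +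
            ∑ t ∈ Finset.Ico 1 T,
              ENNReal.ofReal (η t) * Diffusion.scoreErrorSq α η pdata s t) := by
  obtain ⟨K, hK0, hmoment⟩ := Diffusion.exists_moment_order hb₁
  refine ⟨K, hK0, 3 * (Real.exp (3 * b₂)).toNNReal, ?_⟩
  intro B ⟨hb₁B, hBb₂⟩ d T α η δ pdata pinit s hT _ _ hs hα hη hδ hδ2 hK
  have hB : 0 < B := hb₁.trans_le hb₁B
  refine ⟨Diffusion.isProbabilityMeasure_backwardLaw hB hs pinit 1 (T - 1), ?_⟩
  let error t := ENNReal.ofReal (Real.exp (3 * B)) *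
    (ENNReal.ofReal (η t) * Diffusion.scoreErrorSq α η pdata s t + ENNReal.ofReal δ * 3)
  have hkl := Diffusion.klDiv_backwardLaw_le (error := error) hB hs pdata pinit 1 (T - 1)
    fun t ht ν _ => by
      obtain ⟨i, rfl⟩ := Nat.exists_eq_add_of_le' ht.1
      have hi : i + 1 < T := by have := ht.2; omega
      have hv : 0 < Diffusion.noiseVar α η (i + 1) :=
        Diffusion.noiseVar_succ_pos (hα i (by omega)) fun j hj => hη j (by omega)
      obtain ⟨m, hm, hmv, hmδ⟩ :=
        hmoment B δ _ _ d hb₁B hδ hδ2 (hη _ hi) hv (hK (i + 1) (by omega) hi)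
      exact Diffusion.klDiv_bind_backwardStep_le hB pdata (hs _) (hα _ hi)
        (fun j hj => hη j (by omega)) hv hm hmv hmδ ν
  rw [Nat.add_sub_cancel' hT] at hkl
  have hexp : 1 ≤ ENNReal.ofReal (Real.exp (3 * B)) :=
    ENNReal.one_le_ofReal.2 (Real.one_le_exp (by positivity))
  refine (hkl.trans (Diffusion.add_sum_le_three_mul hexp _ T δ)).trans ?_
  rw [ENNReal.coe_mul, ← ENNReal.ofReal]
  gcongr
  rfl
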